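/- Consider a dual-hop amplify-and-forward system with a single-antenna source, an $N$-antenna relay, a single-antenna destination and $M\ge 0$ interferers at the relay. The channel vectors $\mathbf h_1,\mathbf h_2,\mathbf h_{I1},\dots,\mathbf h_{IM}\in\mathbb C^N$ are mutually independent with i.i.d. $\mathcal{CN}(0,1)$ entries; let $\mathbf H_I=[\mathbf h_{I1},\dots,\mathbf h_{IM}]$. Let $\rho_1,\rho_2>0$ be the source and relay powers and $\rho_{I1},\dots,\rho_{IM}\ge 0$ the interferer powers, all divided by the noise variance. With relay matrix $\mathbf W$ the end-to-end SINR is $$\gamma=\frac{|\mathbf h_2^\dagger\mathbf W\mathbf h_1|^2\rho_1}{\sum_{i=1}^M|\mathbf h_2^\dagger\mathbf W\mathbf h_{Ii}|^2\rho_{Ii}+\|\mathbf h_2^\dagger\mathbf W\|^2+1},$$ where $\mathbf W=\omega\frac{\mathbf h_2}{\|\mathbf h_2\|}\mathbf w_1$ and $\omega^2=\rho_2/\big(|\mathbf w_1\mathbf h_1|^2\rho_1+\sum_i|\mathbf w_1\mathbf h_{Ii}|^2\rho_{Ii}+\|\mathbf w_1\|^2\big)$. The ZF/MRT scheme (for $N>M$)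 uses $\mathbf w_1=\mathbf h_1^\dagger\mathbf P/\sqrt{\mathbf h_1^\dagger\mathbf P\mathbf h_1}$ with $\mathbf P=\mathbf I_N-\mathbf H_I(\mathbf H_I^\dagger\mathbf H_I)^{-1}\mathbf H_I^\dagger$. The MMSE/MRT scheme is considered for equal powers $\rho_{Ii}=\rho_I>0$ and uses $\mathbf w_1=\mathbf h_1^\dagger(\mathbf h_1\mathbf h_1^\dagger+\mathbf H_I\mathbf H_I^\dagger+\rho_I^{-1}\mathbf I_N)^{-1}$. Let $C_{\sf ZF}(N)$ and $C_{\sf MMSE}(N)$ be the corresponding ergodic capacities $\frac12\mathrm E[\log_2(1+\gamma)]$, and let $C_{\rm free}(N)=\frac12\mathrm E[\log_2(1+\gamma^\infty)]$ be that of the interference-free system with SNR $\gamma^\infty=\frac{\gamma_1\gamma_2}{\gamma_1+\gamma_2+1}$, $\gamma_i=\rho_i\|\mathbf h_i\|^2$. Define $$C_{\sf LN}(N)=\frac1{2\ln2}\Bigg(\sum_{k=0}^{N-1}\frac{e^{1/\rho_1}}{\rho_1^k}\Gamma\Big(-k,\frac1{\rho_1}\Big)+\sum_{j=0}^{N-1}\frac{e^{1/\rho_2}}{\rho_2^j}\Gamma\Big(-j,\frac1{\rho_2}\Big)-\sum_{k=0}^{N-1}\Psi\Big(1,1-k;\frac1{\rho_1}\Big)-\sum_{j=0}^{N-1}\Psi\Big(1,1-j;\frac1{\rho_2}\Big)+\rho_1\rho_2\sum_{k=0}^{N-1}\sum_{j=0}^{N-1}\frac{G_{k,j}(\rho_1,\rho_2)}{\Gamma(k+1)\Gamma(j+1)}\Bigg).$$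 Here $\Gamma(a,x)$ is the upper incomplete gamma function, $\Psi$ is the confluent hypergeometric function of the second kind, and $G_{k,j}$ is the two-variable Meijer function ${\rm G}^{1,1,1,1,1}_{1,[1:1],0,[1:1]}$ with parameters $2;\,-k;\,-j;\,-;\,0;\,0$, i.e. $$G_{k,j}(x,y)=\frac1{(2\pi i)^2}\iint\Gamma(2+s+t)\,\Gamma(1+k+s)\,\Gamma(-s)\,\Gamma(1+j+t)\,\Gamma(-t)\,x^s y^t\,ds\,dt$$ over vertical lines $\operatorname{Re}s=\sigma$, $\operatorname{Re}t=\tau$ with $-(k+1)<\sigma<0$, $-(j+1)<\tau<0$ and $\sigma+\tau>-2$. Then all three capacities are finite ($C_{\sf ZF}(N)$ for $N>M$). For every $N$, $C_{\rm free}(N)=C_{\sf LN}(N)$ exactly. For every fixed $M$, $C_{\sf ZF}(N)-C_{\sf LN}(N)\to0$ and $C_{\sf MMSE}(N)-C_{\sf LN}(N)\to0$ as $N\to\infty$. -/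

import Mathlib

open MeasureTheory ProbabilityTheory Filter Topology

noncomputable section

namespace DualHop

/-! ### Special functions -/

/-- Upper incomplete gamma function `Γ(a, x) = ∫ₓ^∞ t^(a-1) e^(-t) dt`, for real `a` and `x > 0`. -/
def upperGamma (a x : ℝ) : ℝ :=
  ∫ t in Set.Ioi x, t ^ (a - 1) * Real.exp (-t)

/-- Confluent hypergeometric function of the second kind
`Ψ(a, b; z) = Γ(a)⁻¹ ∫₀^∞ e^(-zt) t^(a-1) (1+t)^(b-a-1) dt`, for `a > 0`, real `b` and `z > 0`. -/
def tricomiPsi (a b z : ℝ) : ℝ :=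
  (Real.Gamma a)⁻¹ *
    ∫ t in Set.Ioi (0 : ℝ), Real.exp (-(z * t)) * t ^ (a - 1) * (1 + t) ^ (b - a - 1)

/-- The Mellin–Barnes integrand of the two-variable Meijer function
`G^{1,1,1,1,1}_{1,[1:1],0,[1:1]} (x, y | a; c; e; -; d; f)`:
`Γ(a+s+t) Γ(1-c+s) Γ(d-s) Γ(1-e+t) Γ(f-t) x^s y^t`. -/
def meijerG2Integrand (a c e d f x y : ℝ) (s t : ℂ) : ℂ :=
  Complex.Gamma (a + s + t) *
    (Complex.Gamma (1 - c + s) * Complex.Gamma (d - s)) *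
    (Complex.Gamma (1 - e + t) * Complex.Gamma (f - t)) *
    ((x : ℂ) ^ s * (y : ℂ) ^ t)

/-- The vertical lines `Re s = p.1` and `Re t = p.2` separate the poles of
`Γ(a+s+t)`, `Γ(1-c+s)`, `Γ(1-e+t)` (on the left) from those of `Γ(d-s)`, `Γ(f-t)`
(on the right). -/
def SeparatesPoles (a c e d f : ℝ) (p : ℝ × ℝ) : Prop :=
  c - 1 < p.1 ∧ p.1 < d ∧ e - 1 < p.2 ∧ p.2 < f ∧ -a < p.1 + p.2

/-- The double contour integral
`(2πi)⁻² ∫_{Re s = p.1} ∫_{Re t = p.2} (integrand) dt ds`,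
parametrised by `s = p.1 + i u`, `t = p.2 + i v`. -/
def meijerG2Contour (a c e d f x y : ℝ) (p : ℝ × ℝ) : ℂ :=
  (1 / (2 * (Real.pi : ℂ)) ^ 2) *
    ∫ q : ℝ × ℝ,
      meijerG2Integrand a c e d f x y (p.1 + q.1 * Complex.I) (p.2 + q.2 * Complex.I)

open Classical in
/-- The generalized Meijer G-function of two variables
`G^{1,1,1,1,1}_{1,[1:1],0,[1:1]} (x, y | a; c; e; -; d; f)`, for `x, y > 0` and real parameters
admitting vertical contours that separate the poles: the double Mellin–Barnes integral along
such contours. (By Cauchy's theorem the value does not depend on which ones are taken.) -/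
def meijerG2 (a c e d f x y : ℝ) : ℂ :=
  if h : ∃ p : ℝ × ℝ, SeparatesPoles a c e d f p then
    meijerG2Contour a c e d f x y h.choose
  else 0

/-! ### The channel -/

/-- The complex Gaussian law `CN(0,1)`: independent real and imaginary parts, each `N(0, 1/2)`. -/
def complexNormal : Measure ℂ :=
  ((gaussianReal 0 (1 / 2)).prod (gaussianReal 0 (1 / 2))).map
    Complex.measurableEquivRealProd.symm

/-- The law of a vector of `N` i.i.d. `CN(0,1)` entries. -/
def vectorLaw (N : ℕ) : Measure (Fin N → ℂ) :=
  Measure.pi fun _ => complexNormal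

/-- A realization of the channels: the source–relay channel `h₁`, the relay–destination channel
`h₂`, and the interferer–relay channels `h_{I1}, …, h_{IM}`. -/
abbrev Channel (N M : ℕ) : Type :=
  (Fin N → ℂ) × (Fin N → ℂ) × (Fin M → Fin N → ℂ)

/-- The joint law of the channels: all entries of all channel vectors are i.i.d. `CN(0,1)`. -/
def channelLaw (N M : ℕ) : Measure (Channel N M) :=
  (vectorLaw N).prod ((vectorLaw N).prod (Measure.pi fun _ => vectorLaw N))

/-- The `N × M` matrix `H_I` whose columns are the interferer channels. -/
def interfererMatrix {N M : ℕ} (hI : Fin M → Fin N → ℂ) : Matrix (Fin N) (Fin M) ℂ :=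
  Matrix.of fun n i => hI i n

/-- `‖v‖²`, the squared Euclidean (Frobenius) norm. -/
def sqNorm {N : ℕ} (v : Fin N → ℂ) : ℝ := ∑ n, ‖v n‖ ^ 2

/-! ### SINR and linear processing at the relay

Powers are normalised by the noise variance `N₀`: `ρ₁ = P/N₀`, `ρ₂ = P_r/N₀`, `ρ_{Ii} = P_{Ii}/N₀`. -/

/-- End-to-end SINR for the relay transformation matrix `W`:
`|h₂†W h₁|² ρ₁ / (∑ᵢ |h₂†W h_{Ii}|² ρ_{Ii} + ‖h₂†W‖² + 1)`. -/
def sinr {N M : ℕ} (ρ₁ : ℝ) (ρI : Fin M → ℝ) (h : Channel N M)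
    (W : Matrix (Fin N) (Fin N) ℂ) : ℝ :=
  ‖star h.2.1 ⬝ᵥ W.mulVec h.1‖ ^ 2 * ρ₁ /
    (∑ i, ‖star h.2.1 ⬝ᵥ W.mulVec (h.2.2 i)‖ ^ 2 * ρI i
      + sqNorm (Matrix.vecMul (star h.2.1) W) + 1)

/-- The squared power factor `ω²` meeting the relay power constraint for the combiner `w`:
`ρ₂ / (|w h₁|² ρ₁ + ∑ᵢ |w h_{Ii}|² ρ_{Ii} + ‖w‖²)`. -/
def powerFactorSq {N M : ℕ} (ρ₁ ρ₂ : ℝ) (ρI : Fin M → ℝ) (h : Channel N M)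
    (w : Fin N → ℂ) : ℝ :=
  ρ₂ / (‖w ⬝ᵥ h.1‖ ^ 2 * ρ₁ + ∑ i, ‖w ⬝ᵥ h.2.2 i‖ ^ 2 * ρI i + sqNorm w)

/-- The rank-one relay matrix `W = ω (h₂ / ‖h₂‖) w`: combining with the row vector `w`, then
maximum ratio transmission. -/
def relayMatrix {N M : ℕ} (ρ₁ ρ₂ : ℝ) (ρI : Fin M → ℝ) (h : Channel N M)
    (w : Fin N → ℂ) : Matrix (Fin N) (Fin N) ℂ :=
  ((√(powerFactorSq ρ₁ ρ₂ ρI h w) / √(sqNorm h.2.1) : ℝ) : ℂ) • Matrix.vecMulVec h.2.1 w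

/-- `P = I - H (H†H)⁻¹ H†`. -/
def zfProjection {N M : ℕ} (H : Matrix (Fin N) (Fin M) ℂ) : Matrix (Fin N) (Fin N) ℂ :=
  1 - H * (H.conjTranspose * H)⁻¹ * H.conjTranspose

/-- The zero-forcing combiner `h₁†P / √(h₁†P h₁)`. -/
def zfCombiner {N M : ℕ} (h : Channel N M) : Fin N → ℂ :=
  let P := zfProjection (interfererMatrix h.2.2)
  ((1 / √((star h.1 ⬝ᵥ P.mulVec h.1).re) : ℝ) : ℂ) • Matrix.vecMul (star h.1) P

/-- The MMSE combiner `h₁† (h₁h₁† + H_I H_I† + (1/ρ_I) I)⁻¹`, for interferers of equal normalised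
power `ρ_I`. -/
def mmseCombiner {N M : ℕ} (ρI : ℝ) (h : Channel N M) : Fin N → ℂ :=
  let H := interfererMatrix h.2.2
  Matrix.vecMul (star h.1)
    (Matrix.vecMulVec h.1 (star h.1) + H * H.conjTranspose + ((1 / ρI : ℝ) : ℂ) • 1)⁻¹

/-- End-to-end SINR of the ZF/MRT scheme. -/
def sinrZF {N M : ℕ} (ρ₁ ρ₂ : ℝ) (ρI : Fin M → ℝ) (h : Channel N M) : ℝ :=
  sinr ρ₁ ρI h (relayMatrix ρ₁ ρ₂ ρI h (zfCombiner h))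

/-- End-to-end SINR of the MMSE/MRT scheme, with interferers of equal power. -/
def sinrMMSE {N M : ℕ} (ρ₁ ρ₂ ρI : ℝ) (h : Channel N M) : ℝ :=
  sinr ρ₁ (fun _ => ρI) h (relayMatrix ρ₁ ρ₂ (fun _ => ρI) h (mmseCombiner ρI h))

/-- End-to-end SNR `γ₁γ₂ / (γ₁ + γ₂ + 1)` of the same system without interference, where
`γᵢ = ρᵢ ‖hᵢ‖²`. -/
def snrFree {N : ℕ} (ρ₁ ρ₂ : ℝ) (h : (Fin N → ℂ) × (Fin N → ℂ)) : ℝ :=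
  (ρ₁ * sqNorm h.1) * (ρ₂ * sqNorm h.2) / (ρ₁ * sqNorm h.1 + ρ₂ * sqNorm h.2 + 1)

/-! ### Ergodic capacity -/

/-- Instantaneous mutual information `(1/2) log₂ (1 + γ)`. -/
def mutualInfo (γ : ℝ) : ℝ := 1 / 2 * Real.logb 2 (1 + γ)

/-- Ergodic capacity of the ZF/MRT scheme. -/
def capacityZF (N M : ℕ) (ρ₁ ρ₂ : ℝ) (ρI : Fin M → ℝ) : ℝ :=
  ∫ h, mutualInfo (sinrZF ρ₁ ρ₂ ρI h) ∂(channelLaw N M)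

/-- Ergodic capacity of the MMSE/MRT scheme. -/
def capacityMMSE (N M : ℕ) (ρ₁ ρ₂ ρI : ℝ) : ℝ :=
  ∫ h, mutualInfo (sinrMMSE ρ₁ ρ₂ ρI h) ∂(channelLaw N M)

/-- Ergodic capacity of the interference-free system. -/
def capacityFree (N : ℕ) (ρ₁ ρ₂ : ℝ) : ℝ :=
  ∫ h, mutualInfo (snrFree ρ₁ ρ₂ h) ∂((vectorLaw N).prod (vectorLaw N))

/-- The closed-form expression `C_LN`. -/
def capacityLN (N : ℕ) (ρ₁ ρ₂ : ℝ) : ℂ :=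
  1 / (2 * (Real.log 2 : ℂ)) *
    (((∑ k ∈ Finset.range N, (1 / ρ₁) ^ k * Real.exp (1 / ρ₁) * upperGamma (-(k : ℝ)) (1 / ρ₁)
        + ∑ j ∈ Finset.range N, (1 / ρ₂) ^ j * Real.exp (1 / ρ₂) * upperGamma (-(j : ℝ)) (1 / ρ₂)
        - ∑ k ∈ Finset.range N, tricomiPsi 1 (1 - k) (1 / ρ₁)
        - ∑ j ∈ Finset.range N, tricomiPsi 1 (1 - j) (1 / ρ₂) : ℝ) : ℂ)
      + ρ₁ * ρ₂ * ∑ k ∈ Finset.range N, ∑ j ∈ Finset.range N,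
          1 / (Complex.Gamma (k + 1) * Complex.Gamma (j + 1)) *
            meijerG2 2 (-(k : ℝ)) (-(j : ℝ)) 0 0 ρ₁ ρ₂)

end DualHop

end

open DualHop

/-! ### Moments of complex Gaussian vectors -/

/-! Exact formula. With a = ρ₁‖h₁‖² and b = ρ₂‖h₂‖², 1 + ab/(a+b+1) = (1+a)(1+b)/(1+a+b), so
Frullani's integral writes the logarithm of the left side as ∫₀^∞ z⁻¹ e^(-z) (1 - e^(-za)) (1 -
e^(-zb)) dz. The channels are independent and E e^(-s‖h‖²) = (1+s)^(-N), so the expectation is the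
same integral with each exponential e^(-za), e^(-zb) replaced by (1+zρᵢ)^(-N)
(`integral_log_snrFree`). On the other side, the incomplete gamma sums of `capacityLN` cancel its Ψ
sums term by term, and each Meijer function is k! j! ∫ z e^(-z) (1+zx)^(-k-1) (1+zy)^(-j-1) dz
(`meijerG2_eq_integral`). Geometric summation over k and j then gives the same integral
(`capacityLN_eq`).

Asymptotics. For any combiner w the SINR is a two-hop expression, increasing in the first-hop SINR.
Cauchy–Schwarz bounds it above by the interference-free SNR. Where the interferer channels are
linearly independent, both schemes have first-hop SINR at least ρ₁q with q = h₁†Ph₁: zero forcing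
because the interference vanishes (`le_sinrZF`), MMSE by positivity of the covariance form
(`le_sinrMMSE`). So the capacity gap is at most a constant times E[log(1+ρ₁‖h₁‖²) - log(1+ρ₁q)],
plus the contribution of the degenerate event.

The discarded power ‖h₁‖² - q has mean tr(I-P) = M, bounded in N, while ‖h₁‖² is of order N;
concavity of the logarithm then makes the gap O(1/√N) (`log_sub_log_le`). The unlikely event ‖h₁‖² <
N/2 is paid for by a Chernoff factor of mean (√e/2)^N. Almost sure linear independence is never
needed: dependence violates diagonal dominance of the Gram matrix H†H, so its indicator is dominated
by a variable of mean O(1/N) (`one_le_dependenceBound`), which beats the O(√N) crude bound on the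
gap there. -/

instance : IsProbabilityMeasure complexNormal :=
  Measure.isProbabilityMeasure_map (by fun_prop)

instance (N : ℕ) : IsProbabilityMeasure (vectorLaw N) := by
  unfold vectorLaw; infer_instance

instance (N M : ℕ) : IsProbabilityMeasure (channelLaw N M) := by
  unfold channelLaw; infer_instance

theorem integral_complexNormal {E : Type*} [NormedAddCommGroup E] [NormedSpace ℝ E] (f : ℂ → E) :
    ∫ z, f z ∂complexNormal =
      ∫ p, f (Complex.measurableEquivRealProd.symm p)
        ∂((gaussianReal 0 (1 / 2)).prod (gaussianReal 0 (1 / 2))) :=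
  integral_map_equiv _ _

theorem integrable_complexNormal {E : Type*} [NormedAddCommGroup E] {f : ℂ → E} :
    Integrable f complexNormal ↔
      Integrable (fun p => f (Complex.measurableEquivRealProd.symm p))
        ((gaussianReal 0 (1 / 2)).prod (gaussianReal 0 (1 / 2))) :=
  integrable_map_equiv _ _

theorem norm_sq_measurableEquivRealProd_symm (p : ℝ × ℝ) :
    ‖Complex.measurableEquivRealProd.symm p‖ ^ 2 = p.1 ^ 2 + p.2 ^ 2 := by
  rw [← Complex.normSq_eq_norm_sq, Complex.normSq_apply]
  simp [Complex.measurableEquivRealProd]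
  ring

theorem integral_exp_neg_mul_sq_gaussianReal {s : ℝ} (hs : 0 ≤ s) :
    ∫ x, Real.exp (-(s * x ^ 2)) ∂(gaussianReal 0 (1 / 2)) = (√(1 + s))⁻¹ := by
  rw [integral_gaussianReal_eq_integral_smul (by norm_num)]
  have h : ∀ x : ℝ, gaussianPDFReal 0 (1 / 2) x • Real.exp (-(s * x ^ 2)) =
      (√Real.pi)⁻¹ * Real.exp (-(1 + s) * x ^ 2) := by
    intro x
    have : (2 : ℝ) * Real.pi * ((1 / 2 : NNReal) : ℝ) = Real.pi := by push_cast; ring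
    rw [gaussianPDFReal, this, smul_eq_mul, mul_assoc, ← Real.exp_add]
    congr 2
    push_cast
    ring
  simp_rw [h]
  rw [integral_const_mul, integral_gaussian, Real.sqrt_div Real.pi_pos.le]
  have := Real.sqrt_pos.2 Real.pi_pos
  field_simp

theorem integral_exp_neg_mul_norm_sq_complexNormal {s : ℝ} (hs : 0 ≤ s) :
    ∫ z, Real.exp (-(s * ‖z‖ ^ 2)) ∂complexNormal = (1 + s)⁻¹ := by
  rw [integral_complexNormal]
  simp_rw [norm_sq_measurableEquivRealProd_symm, mul_add, neg_add, Real.exp_add]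
  rw [integral_prod_mul (fun x => Real.exp (-(s * x ^ 2))) (fun x => Real.exp (-(s * x ^ 2))),
    integral_exp_neg_mul_sq_gaussianReal hs, ← mul_inv, Real.mul_self_sqrt (by positivity)]

theorem integrable_sq_gaussianReal : Integrable (fun x : ℝ => x ^ 2) (gaussianReal 0 (1 / 2)) :=
  (memLp_id_gaussianReal 2).integrable_sq

theorem integral_sq_gaussianReal : ∫ x, x ^ 2 ∂(gaussianReal 0 (1 / 2)) = 1 / 2 := by
  have h := variance_fun_id_gaussianReal (μ := 0) (v := 1 / 2)
  rw [variance_eq_integral (by fun_prop)] at h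
  simpa [integral_id_gaussianReal] using h

theorem integrable_norm_sq_complexNormal : Integrable (fun z : ℂ => ‖z‖ ^ 2) complexNormal := by
  rw [integrable_complexNormal]
  simp_rw [norm_sq_measurableEquivRealProd_symm]
  exact (integrable_sq_gaussianReal.comp_fst _).add (integrable_sq_gaussianReal.comp_snd _)

theorem integral_norm_sq_complexNormal : ∫ z, ‖z‖ ^ 2 ∂complexNormal = 1 := by
  rw [integral_complexNormal]
  simp_rw [norm_sq_measurableEquivRealProd_symm]
  rw [integral_add (integrable_sq_gaussianReal.comp_fst _) (integrable_sq_gaussianReal.comp_snd _),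
    integral_fun_fst (fun x : ℝ => x ^ 2), integral_fun_snd (fun x : ℝ => x ^ 2),
    integral_sq_gaussianReal]
  simp
  norm_num

theorem memLp_id_complexNormal : MemLp (fun z : ℂ => z) 2 complexNormal :=
  (memLp_two_iff_integrable_sq_norm (by fun_prop)).2 integrable_norm_sq_complexNormal

theorem integral_id_complexNormal : ∫ z, z ∂complexNormal = 0 := by
  have hi : Integrable (fun z : ℂ => z) complexNormal :=
    memLp_id_complexNormal.integrable (by norm_num)
  have hg : Integrable (fun x : ℝ => x) (gaussianReal 0 (1 / 2)) :=
    (memLp_id_gaussianReal 2).integrable (by norm_num)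
  apply Complex.ext
  · have := Complex.reCLM.integral_comp_comm hi
    simp only [Complex.reCLM_apply] at this
    rw [← this, integral_complexNormal]
    simp [Complex.measurableEquivRealProd, integral_fun_fst (fun x : ℝ => x),
      integral_id_gaussianReal]
  · have := Complex.imCLM.integral_comp_comm hi
    simp only [Complex.imCLM_apply] at this
    rw [← this, integral_complexNormal]
    simp [Complex.measurableEquivRealProd, integral_fun_snd (fun x : ℝ => x),
      integral_id_gaussianReal]

theorem sqNorm_nonneg {N : ℕ} (v : Fin N → ℂ) : 0 ≤ sqNorm v :=
  Finset.sum_nonneg fun _ _ => by positivity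

@[fun_prop]
theorem measurable_sqNorm {N : ℕ} : Measurable (sqNorm : (Fin N → ℂ) → ℝ) := by
  unfold sqNorm; fun_prop

theorem integrable_norm_sq_eval {N : ℕ} (n : Fin N) :
    Integrable (fun h : Fin N → ℂ => ‖h n‖ ^ 2) (vectorLaw N) :=
  (measurePreserving_eval (fun _ : Fin N => complexNormal) n).integrable_comp_of_integrable
    integrable_norm_sq_complexNormal

theorem integrable_sqNorm (N : ℕ) : Integrable sqNorm (vectorLaw N) :=
  integrable_finsetSum _ fun n _ => integrable_norm_sq_eval n

theorem integral_comp_eval_vectorLaw {N : ℕ} (n : Fin N) {E : Type*} [NormedAddCommGroup E]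
    [NormedSpace ℝ E] (f : ℂ → E) (hf : AEStronglyMeasurable f complexNormal) :
    ∫ h, f (h n) ∂(vectorLaw N) = ∫ z, f z ∂complexNormal := by
  have := (measurePreserving_eval (fun _ : Fin N => complexNormal) n)
  rw [← this.map_eq] at hf
  have h := integral_map this.measurable.aemeasurable hf
  rw [this.map_eq] at h
  exact h.symm

theorem integral_sqNorm (N : ℕ) : ∫ h, sqNorm h ∂(vectorLaw N) = N := by
  unfold sqNorm
  rw [integral_finsetSum _ fun n _ => integrable_norm_sq_eval n]
  have : ∀ n : Fin N, ∫ h, ‖h n‖ ^ 2 ∂(vectorLaw N) = 1 := fun n => by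
    rw [integral_comp_eval_vectorLaw n (fun z => ‖z‖ ^ 2) (by fun_prop),
      integral_norm_sq_complexNormal]
  simp [this]

/-- The entries are independent, and each contributes a factor (1+s)⁻¹. This transform yields the
exact capacity for s = zρ, and the Chernoff bounds for s = 1. -/
theorem integral_exp_neg_mul_sqNorm (N : ℕ) {s : ℝ} (hs : 0 ≤ s) :
    ∫ h, Real.exp (-(s * sqNorm h)) ∂(vectorLaw N) = ((1 + s) ^ N)⁻¹ := by
  have : ∀ h : Fin N → ℂ, Real.exp (-(s * sqNorm h)) = ∏ n, Real.exp (-(s * ‖h n‖ ^ 2)) := by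
    intro h
    rw [← Real.exp_sum, sqNorm, Finset.mul_sum, Finset.sum_neg_distrib]
  simp_rw [this]
  unfold vectorLaw
  rw [integral_fintype_prod_eq_pow (fun z => Real.exp (-(s * ‖z‖ ^ 2))),
    integral_exp_neg_mul_norm_sq_complexNormal hs]
  simp

theorem memLp_eval_vectorLaw {N : ℕ} (n : Fin N) : MemLp (fun h => h n) 2 (vectorLaw N) :=
  memLp_id_complexNormal.comp_measurePreserving (measurePreserving_eval _ n)

theorem integrable_star_mul_vectorLaw {N : ℕ} (n m : Fin N) :
    Integrable (fun h => star (h n) * h m) (vectorLaw N) :=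
  MemLp.integrable_mul (memLp_eval_vectorLaw n).star (memLp_eval_vectorLaw m)

theorem integral_star_mul_vectorLaw {N : ℕ} (n m : Fin N) :
    ∫ h, star (h n) * h m ∂(vectorLaw N) = if n = m then 1 else 0 := by
  split_ifs with hnm
  · subst hnm
    have : ∀ h : Fin N → ℂ, star (h n) * h n = ((‖h n‖ ^ 2 : ℝ) : ℂ) := fun h => by
      simpa using RCLike.conj_mul (h n)
    simp_rw [this]
    rw [integral_complex_ofReal, integral_comp_eval_vectorLaw n (fun z => ‖z‖ ^ 2) (by fun_prop),
      integral_norm_sq_complexNormal, Complex.ofReal_one]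
  · have hind : IndepFun (fun h : Fin N → ℂ => star (h n)) (fun h => h m) (vectorLaw N) :=
      ((iIndepFun_pi (μ := fun _ : Fin N => complexNormal) (X := fun _ z => z)
        fun _ => aemeasurable_id).indepFun hnm).comp (φ := star) (ψ := id)
        (by fun_prop) measurable_id
    rw [hind.integral_fun_mul_eq_mul_integral (memLp_eval_vectorLaw n).star.1
      (memLp_eval_vectorLaw m).1,
      integral_comp_eval_vectorLaw m (fun z => z) (by fun_prop), integral_id_complexNormal,
      mul_zero]

theorem dotProduct_mulVec_eq_sum {N : ℕ} (A : Matrix (Fin N) (Fin N) ℂ) (h : Fin N → ℂ) :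
    star h ⬝ᵥ A.mulVec h = ∑ n, ∑ m, A n m * (star (h n) * h m) := by
  simp only [dotProduct, Matrix.mulVec, Finset.mul_sum, Pi.star_apply]
  exact Finset.sum_congr rfl fun n _ => Finset.sum_congr rfl fun m _ => by ring

theorem integrable_quadraticForm {N : ℕ} (A : Matrix (Fin N) (Fin N) ℂ) :
    Integrable (fun h => star h ⬝ᵥ A.mulVec h) (vectorLaw N) := by
  simp_rw [dotProduct_mulVec_eq_sum]
  exact integrable_finsetSum _ fun n _ => integrable_finsetSum _ fun m _ =>
    (integrable_star_mul_vectorLaw n m).const_mul _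

/-- The entries are uncorrelated with unit variance, so only the diagonal of A survives. Used with I
- P to compute the mean loss, and with xx† for the correlation of two channels. -/
theorem integral_quadraticForm {N : ℕ} (A : Matrix (Fin N) (Fin N) ℂ) :
    ∫ h, star h ⬝ᵥ A.mulVec h ∂(vectorLaw N) = A.trace := by
  simp_rw [dotProduct_mulVec_eq_sum]
  refine (integral_finsetSum _ fun n _ => integrable_finsetSum _ fun m _ =>
    (integrable_star_mul_vectorLaw n m).const_mul _).trans ?_
  refine Finset.sum_congr rfl fun n _ => ?_
  refine (integral_finsetSum _ fun m _ =>
    (integrable_star_mul_vectorLaw n m).const_mul _).trans ?_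
  simp_rw [integral_const_mul, integral_star_mul_vectorLaw]
  simp

/-! ### Mellin–Barnes integrals -/

theorem norm_Gamma_le_Gamma_re {w : ℂ} (hw : 0 < w.re) : ‖Complex.Gamma w‖ ≤ Real.Gamma w.re := by
  rw [Complex.Gamma_eq_integral hw, Complex.GammaIntegral, Real.Gamma_eq_integral hw]
  refine (norm_integral_le_integral_norm _).trans (le_of_eq ?_)
  refine setIntegral_congr_fun measurableSet_Ioi fun x (hx : 0 < x) => ?_
  simp only [norm_mul, Complex.norm_real, Complex.norm_cpow_eq_rpow_re_of_pos hx,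
    Complex.sub_re, Complex.one_re, Real.norm_eq_abs, Real.abs_exp]

/-- Two uses of the functional equation turn boundedness of Γ on vertical lines into quadratic
decay, which suffices for integrability without Stirling's formula. -/
theorem norm_Gamma_le_div {w : ℂ} (hw : 0 < w.re) :
    ‖Complex.Gamma w‖ ≤ Real.Gamma (w.re + 2) / (w.re ^ 2 + w.im ^ 2) := by
  have h0 : w ≠ 0 := fun h => by simp [h] at hw
  have h1 : w + 1 ≠ 0 := fun h => by
    have := congrArg Complex.re h
    simp at this
    linarith
  have hG : Complex.Gamma (w + 2) = (w + 1) * (w * Complex.Gamma w) := by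
    rw [show w + 2 = w + 1 + 1 by ring, Complex.Gamma_add_one _ h1, Complex.Gamma_add_one _ h0]
  have hle := norm_Gamma_le_Gamma_re (w := w + 2) (by simp; linarith)
  rw [hG, norm_mul, norm_mul] at hle
  have hsq : w.re ^ 2 + w.im ^ 2 = ‖w‖ * ‖w‖ := by
    rw [Complex.norm_mul_self_eq_normSq, Complex.normSq_apply]; ring
  have hw1 : ‖w‖ ≤ ‖w + 1‖ := by
    rw [Complex.norm_def, Complex.norm_def]
    apply Real.sqrt_le_sqrt
    simp only [Complex.normSq_apply, Complex.add_re, Complex.one_re, Complex.add_im,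
      Complex.one_im]
    nlinarith
  rw [hsq, le_div_iff₀ (by positivity)]
  calc _ = ‖w‖ * (‖w‖ * ‖Complex.Gamma w‖) := by ring
    _ ≤ ‖w + 1‖ * (‖w‖ * ‖Complex.Gamma w‖) := by gcongr
    _ ≤ _ := by simpa using hle

theorem continuous_Gamma_verticalLine {σ : ℝ} (hσ : 0 < σ) (ε : ℝ) :
    Continuous fun u : ℝ => Complex.Gamma (σ + ε * u * Complex.I) := by
  rw [continuous_iff_continuousAt]
  intro u
  have : ContinuousAt Complex.Gamma (σ + ε * u * Complex.I) := by
    refine (Complex.differentiableAt_Gamma _ fun m h => ?_).continuousAt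
    have := congrArg Complex.re h
    simp at this
    have : (0 : ℝ) ≤ m := m.cast_nonneg
    linarith
  exact this.comp (f := fun u : ℝ => (σ + ε * u * Complex.I : ℂ)) (by fun_prop)

theorem integrable_Gamma_verticalLine {σ : ℝ} (hσ : 0 < σ) :
    Integrable fun u : ℝ => Complex.Gamma (σ + u * Complex.I) := by
  have hc := continuous_Gamma_verticalLine hσ 1
  simp only [Complex.ofReal_one, one_mul] at hc
  refine Integrable.mono' (integrable_inv_one_add_sq.const_mul
    (Real.Gamma (σ + 2) / min 1 (σ ^ 2))) hc.aestronglyMeasurable (ae_of_all _ fun u => ?_)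
  have hm : 0 < min 1 (σ ^ 2) := by positivity
  have := norm_Gamma_le_div (w := σ + u * Complex.I) (by simpa)
  simp only [Complex.add_re, Complex.ofReal_re, Complex.mul_re, Complex.I_re, mul_zero,
    Complex.ofReal_im, Complex.I_im, mul_one, sub_self, add_zero, Complex.add_im, Complex.mul_im,
    zero_add] at this
  refine this.trans ?_
  rw [← div_eq_mul_inv, div_div]
  have hG : 0 ≤ Real.Gamma (σ + 2) := (Real.Gamma_pos_of_pos (by linarith)).le
  gcongr
  nlinarith [min_le_left 1 (σ ^ 2), min_le_right 1 (σ ^ 2), sq_nonneg u]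

theorem integrable_Gamma_neg_verticalLine {σ : ℝ} (hσ : σ < 0) :
    Integrable fun u : ℝ => Complex.Gamma (-(σ + u * Complex.I)) := by
  have := (integrable_Gamma_verticalLine (σ := -σ) (by linarith)).comp_neg
  refine this.congr (ae_of_all _ fun u => ?_)
  simp only
  congr 1
  push_cast
  ring

/-- Mellin inversion of e^(-x), whose Mellin transform is Γ, along Re s = -σ > 0, followed by u ↦
-u. -/
theorem integral_Gamma_neg_mul_cpow {σ X : ℝ} (hσ : σ < 0) (hX : 0 < X) :
    ∫ u : ℝ, Complex.Gamma (-(σ + u * Complex.I)) * (X : ℂ) ^ (σ + u * Complex.I : ℂ) =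
      2 * Real.pi * Real.exp (-X) := by
  have hσ' : 0 < -σ := by linarith
  have hmel : ∀ s : ℂ, 0 < s.re →
      mellin (fun x : ℝ => (Real.exp (-x) : ℂ)) s = Complex.Gamma s := fun s hs => by
    rw [Complex.Gamma_eq_integral hs, Complex.GammaIntegral, mellin]
    simp [mul_comm]
  have hconv : MellinConvergent (fun x : ℝ => (Real.exp (-x) : ℂ)) (-σ : ℝ) := by
    have := Complex.GammaIntegral_convergent (s := ((-σ : ℝ) : ℂ)) (by simpa)
    refine this.congr_fun (fun x _ => ?_) measurableSet_Ioi
    simp [mul_comm]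
  have heq : ∀ u : ℝ, mellin (fun x : ℝ => (Real.exp (-x) : ℂ)) ((-σ : ℝ) + u * Complex.I) =
      Complex.Gamma ((-σ : ℝ) + u * Complex.I) := fun u => hmel _ (by simpa)
  have hvert : Complex.VerticalIntegrable (mellin (fun x : ℝ => (Real.exp (-x) : ℂ))) (-σ) := by
    unfold Complex.VerticalIntegrable
    simp_rw [heq]
    exact integrable_Gamma_verticalLine hσ'
  have hinv := mellinInv_mellin_eq (-σ) (fun x : ℝ => (Real.exp (-x) : ℂ)) hX hconv hvert
    (by fun_prop)
  rw [mellinInv] at hinv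
  simp_rw [heq] at hinv
  rw [← hinv, ← integral_neg_eq_self, Complex.real_smul, ← mul_assoc]
  have hpi : (Real.pi : ℂ) ≠ 0 := Complex.ofReal_ne_zero.2 Real.pi_pos.ne'
  rw [show (2 * (Real.pi : ℂ)) * ((1 / (2 * Real.pi) : ℝ) : ℂ) = 1 by
    push_cast; field_simp, one_mul]
  refine integral_congr_ae (ae_of_all _ fun u => ?_)
  simp only [smul_eq_mul]
  rw [mul_comm]
  push_cast
  congr 2 <;> ring_nf

/-- Fubini for Euler's integral of `Γ` along a family of arguments with constant real part. -/
theorem integral_mul_Gamma {α : Type*} [MeasurableSpace α] {μ : Measure α} [SFinite μ]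
    {g e : α → ℂ} {a : ℝ} (ha : 0 < a) (hg : Integrable g μ) (he : Measurable e)
    (hre : ∀ q, (e q).re = a) :
    ∫ q, g q * Complex.Gamma (e q) ∂μ =
      ∫ w in Set.Ioi (0 : ℝ), (Real.exp (-w) : ℂ) * ∫ q, g q * (w : ℂ) ^ (e q - 1) ∂μ := by
  have hint : Integrable (fun p : α × ℝ => g p.1 * ((Real.exp (-p.2) : ℂ) *
      (p.2 : ℂ) ^ (e p.1 - 1))) (μ.prod (volume.restrict (Set.Ioi 0))) := by
    have hR : Integrable (fun x : ℝ => Real.exp (-x) * x ^ (a - 1))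
      (volume.restrict (Set.Ioi 0)) := Real.GammaIntegral_convergent ha
    refine (hg.norm.mul_prod hR).mono' ?_ ?_
    · refine hg.aestronglyMeasurable.comp_fst.mul ?_
      have : Measurable fun p : α × ℝ => (Real.exp (-p.2) : ℂ) * (p.2 : ℂ) ^ (e p.1 - 1) := by
        fun_prop
      exact this.aestronglyMeasurable
    · have : ∀ᵐ p ∂(μ.prod (volume.restrict (Set.Ioi (0 : ℝ)))), p.2 ∈ Set.Ioi (0 : ℝ) :=
        Measure.quasiMeasurePreserving_snd.ae (ae_restrict_mem measurableSet_Ioi)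
      filter_upwards [this] with p (hp : 0 < p.2)
      rw [norm_mul, norm_mul, Complex.norm_real, Complex.norm_cpow_eq_rpow_re_of_pos hp,
        Complex.sub_re, hre, Complex.one_re, Real.norm_eq_abs, Real.abs_exp]
  calc _ = ∫ q, (∫ w in Set.Ioi (0 : ℝ), g q * ((Real.exp (-w) : ℂ) * (w : ℂ) ^ (e q - 1))) ∂μ := by
        congr with q
        rw [integral_const_mul, Complex.Gamma_eq_integral (by rw [hre]; exact ha),
          Complex.GammaIntegral]
    _ = ∫ w in Set.Ioi (0 : ℝ), (∫ q, g q * ((Real.exp (-w) : ℂ) * (w : ℂ) ^ (e q - 1)) ∂μ) :=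
        integral_integral_swap hint
    _ = _ := by
        congr with w
        rw [← integral_const_mul]
        congr with q
        ring

theorem norm_cpow_verticalLine {X : ℝ} (hX : 0 < X) (σ u : ℝ) :
    ‖(X : ℂ) ^ (σ + u * Complex.I : ℂ)‖ = X ^ σ := by
  rw [Complex.norm_cpow_eq_rpow_re_of_pos hX]
  simp

theorem integrable_Gamma_neg_mul_cpow {σ X : ℝ} (hσ : σ < 0) (hX : 0 < X) :
    Integrable fun u : ℝ =>
      Complex.Gamma (-(σ + u * Complex.I)) * (X : ℂ) ^ (σ + u * Complex.I : ℂ) :=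
  (integrable_Gamma_neg_verticalLine hσ).mul_bdd (c := X ^ σ)
    (Measurable.aestronglyMeasurable (by fun_prop))
    (ae_of_all _ fun u => (norm_cpow_verticalLine hX σ u).le)

/-- Γ(-s) is integrable along the line; the other factor only needs to be bounded. -/
theorem integrable_Gamma_mul_Gamma {c σ : ℝ} (hc : -c < σ) (hσ : σ < 0) :
    Integrable fun u : ℝ => Complex.Gamma (c + (σ + u * Complex.I)) *
      Complex.Gamma (-(σ + u * Complex.I)) := by
  have hcont := continuous_Gamma_verticalLine (σ := c + σ) (by linarith) 1
  refine (integrable_Gamma_neg_verticalLine hσ).bdd_mul (c := Real.Gamma (c + σ)) ?_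
    (ae_of_all _ fun u => ?_)
  · refine (hcont.congr fun u => ?_).aestronglyMeasurable
    push_cast
    ring_nf
  · have := norm_Gamma_le_Gamma_re (w := c + (σ + u * Complex.I)) (by simp; linarith)
    simpa using this

theorem integrable_Gamma_mul_Gamma_mul_cpow {c σ X : ℝ} (hc : -c < σ) (hσ : σ < 0) (hX : 0 < X) :
    Integrable fun u : ℝ => Complex.Gamma (c + (σ + u * Complex.I)) *
      Complex.Gamma (-(σ + u * Complex.I)) * (X : ℂ) ^ (σ + u * Complex.I : ℂ) :=
  (integrable_Gamma_mul_Gamma hc hσ).mul_bdd (c := X ^ σ)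
    (Measurable.aestronglyMeasurable (by fun_prop))
    (ae_of_all _ fun u => (norm_cpow_verticalLine hX σ u).le)

theorem ofReal_mul_cpow {x y : ℝ} (hx : 0 < x) (hy : 0 < y) (s : ℂ) :
    ((x * y : ℝ) : ℂ) ^ s = (x : ℂ) ^ s * (y : ℂ) ^ s := by
  rw [Complex.ofReal_mul, Complex.mul_cpow_ofReal_nonneg hx.le hy.le]

/-- The Mellin–Barnes representation of `(1 + X)^(-(k+1))`. -/
theorem integral_Gamma_mul_Gamma_mul_cpow {k : ℕ} {σ X : ℝ} (hc : -((k : ℝ) + 1) < σ) (hσ : σ < 0)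
    (hX : 0 < X) :
    ∫ u : ℝ, Complex.Gamma (((k : ℝ) + 1 : ℝ) + (σ + u * Complex.I)) *
      Complex.Gamma (-(σ + u * Complex.I)) * (X : ℂ) ^ (σ + u * Complex.I : ℂ) =
      2 * Real.pi * (k.factorial * ((1 + X) ^ (k + 1))⁻¹ : ℝ) := by
  -- Expanding Γ(k+1+s) by Euler's integral leaves w^k times the inverse Mellin transform of the
  -- exponential at wX, so the whole becomes 2π ∫ w^k e^(-(1+X)w) dw.
  have h := integral_mul_Gamma (μ := volume) (e := fun u : ℝ =>
    (((k : ℝ) + 1 : ℝ) + (σ + u * Complex.I) : ℂ)) (a := k + 1 + σ) (by linarith)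
    (integrable_Gamma_neg_mul_cpow hσ hX) (by fun_prop) (by intro q; simp)
  calc _ = _ := Eq.trans (integral_congr_ae (ae_of_all _ fun u => by ring)) h
    _ = ∫ w in Set.Ioi (0 : ℝ), ((2 * Real.pi * (w ^ k * Real.exp (-((1 + X) * w))) : ℝ) : ℂ) := by
        refine setIntegral_congr_fun measurableSet_Ioi fun w (hw : 0 < w) => ?_
        have hw' : (w : ℂ) ≠ 0 := Complex.ofReal_ne_zero.2 hw.ne'
        have : ∀ u : ℝ, Complex.Gamma (-(σ + u * Complex.I)) * (X : ℂ) ^ (σ + u * Complex.I : ℂ) *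
            (w : ℂ) ^ ((((k : ℝ) + 1 : ℝ) : ℂ) + (σ + u * Complex.I) - 1) =
            (w : ℂ) ^ k * (Complex.Gamma (-(σ + u * Complex.I)) *
              ((w * X : ℝ) : ℂ) ^ (σ + u * Complex.I : ℂ)) := fun u => by
          rw [ofReal_mul_cpow hw hX, ← Complex.cpow_natCast, show ((((k : ℝ) + 1 : ℝ) : ℂ) +
            (σ + u * Complex.I) - 1) = (k : ℂ) + (σ + u * Complex.I) by push_cast; ring,
            Complex.cpow_add _ _ hw']
          ring
        simp_rw [this]
        rw [integral_const_mul, integral_Gamma_neg_mul_cpow hσ (by positivity)]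
        have : Real.exp (-((1 + X) * w)) = Real.exp (-w) * Real.exp (-(w * X)) := by
          rw [← Real.exp_add]; ring_nf
        rw [this]
        push_cast
        ring
    _ = _ := by
        rw [integral_complex_ofReal, integral_const_mul]
        have := Real.integral_rpow_mul_exp_neg_mul_Ioi (a := k + 1) (r := 1 + X) (by positivity)
          (by positivity)
        simp only [add_sub_cancel_right, Real.rpow_natCast, Real.Gamma_nat_eq_factorial] at this
        rw [this]
        norm_cast
        simp
        ring

theorem integrable_mul_exp_neg_mul_inv_pow {x y : ℝ} (hx : 0 < x) (hy : 0 < y) (m n : ℕ) :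
    IntegrableOn (fun z : ℝ => z * Real.exp (-z) * ((1 + z * x) ^ m)⁻¹ * ((1 + z * y) ^ n)⁻¹)
      (Set.Ioi 0) := by
  have h2 := Real.GammaIntegral_convergent (s := 2) (by norm_num)
  refine h2.mono' (by fun_prop) ?_
  filter_upwards [ae_restrict_mem measurableSet_Ioi] with z (hz : 0 < z)
  rw [Real.norm_of_nonneg (by positivity)]
  have h1 : ((1 + z * x) ^ m)⁻¹ ≤ 1 := inv_le_one_of_one_le₀ (one_le_pow₀ (by nlinarith))
  have h2 : ((1 + z * y) ^ n)⁻¹ ≤ 1 := inv_le_one_of_one_le₀ (one_le_pow₀ (by nlinarith))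
  calc _ ≤ z * Real.exp (-z) * 1 * 1 := by gcongr
    _ = _ := by norm_num; ring

/-- Γ(2+s+t) is the only factor coupling s and t. Euler's integral for it contributes w^(1+s+t),
which splits the double contour integral into two one-variable Mellin–Barnes integrals at wx and wy.
-/
theorem meijerG2_eq_integral {x y : ℝ} (hx : 0 < x) (hy : 0 < y) (k j : ℕ) :
    meijerG2 2 (-(k : ℝ)) (-(j : ℝ)) 0 0 x y =
      ((k.factorial * j.factorial * ∫ z in Set.Ioi (0 : ℝ),
        z * Real.exp (-z) * ((1 + z * x) ^ (k + 1))⁻¹ * ((1 + z * y) ^ (j + 1))⁻¹ : ℝ) : ℂ) := by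
  have hex : ∃ p : ℝ × ℝ, SeparatesPoles 2 (-(k : ℝ)) (-(j : ℝ)) 0 0 p := by
    have hk : (0 : ℝ) ≤ k := k.cast_nonneg
    have hj : (0 : ℝ) ≤ j := j.cast_nonneg
    exact ⟨(-1 / 2, -1 / 2), by linarith, by norm_num, by linarith, by norm_num, by norm_num⟩
  rw [meijerG2, dif_pos hex]
  obtain ⟨h1, h2, h3, h4, h5⟩ := hex.choose_spec
  -- The chosen contour is unknown; only the separation inequalities are used, so no contour shift
  -- is needed.
  generalize hex.choose = p at *
  obtain ⟨σ, τ⟩ := p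
  simp only at h1 h2 h3 h4 h5
  have hk : -((k : ℝ) + 1) < σ := by linarith
  have hj : -((j : ℝ) + 1) < τ := by linarith
  rw [meijerG2Contour]
  have hg := (integrable_Gamma_mul_Gamma_mul_cpow hk h2 hx).mul_prod
    (integrable_Gamma_mul_Gamma_mul_cpow hj h4 hy)
  have h := integral_mul_Gamma (a := 2 + σ + τ) (e := fun q : ℝ × ℝ =>
    (2 + (σ + q.1 * Complex.I) + (τ + q.2 * Complex.I) : ℂ)) (by linarith) hg (by fun_prop)
    (by intro q; simp)
  have hint : ∫ q : ℝ × ℝ, meijerG2Integrand 2 (-(k : ℝ)) (-(j : ℝ)) 0 0 x y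
      (σ + q.1 * Complex.I) (τ + q.2 * Complex.I) =
      ∫ w in Set.Ioi (0 : ℝ), (((2 * Real.pi) ^ 2 * (k.factorial * j.factorial) *
        (w * Real.exp (-w) * ((1 + w * x) ^ (k + 1))⁻¹ * ((1 + w * y) ^ (j + 1))⁻¹) : ℝ) : ℂ) := by
    calc _ = _ := by
          refine Eq.trans (integral_congr_ae (ae_of_all _ fun q => ?_)) h
          simp only [meijerG2Integrand]
          push_cast
          rw [zero_sub, zero_sub, show (1 : ℂ) - -(k : ℂ) = k + 1 by ring,
            show (1 : ℂ) - -(j : ℂ) = j + 1 by ring]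
          ring
      _ = _ := by
          refine setIntegral_congr_fun measurableSet_Ioi fun w (hw : 0 < w) => ?_
          have hw' : (w : ℂ) ≠ 0 := Complex.ofReal_ne_zero.2 hw.ne'
          have hq : ∀ q : ℝ × ℝ, (w : ℂ) ^ (2 + (σ + q.1 * Complex.I) +
              (τ + q.2 * Complex.I) - 1 : ℂ) =
              w * ((w : ℂ) ^ (σ + q.1 * Complex.I : ℂ) * (w : ℂ) ^ (τ + q.2 * Complex.I : ℂ)) := by
            intro q
            rw [show (2 + (σ + q.1 * Complex.I) + (τ + q.2 * Complex.I) - 1 : ℂ) =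
              1 + (σ + q.1 * Complex.I) + (τ + q.2 * Complex.I) by ring,
              Complex.cpow_add _ _ hw', Complex.cpow_add _ _ hw', Complex.cpow_one]
            ring
          have hs := integral_Gamma_mul_Gamma_mul_cpow hk h2 (mul_pos hw hx)
          have ht := integral_Gamma_mul_Gamma_mul_cpow hj h4 (mul_pos hw hy)
          have hst := integral_prod_mul (μ := (volume : Measure ℝ)) (ν := (volume : Measure ℝ))
            (fun u : ℝ => Complex.Gamma (((k : ℝ) + 1 : ℝ) + (σ + u * Complex.I)) *
              Complex.Gamma (-(σ + u * Complex.I)) * ((w * x : ℝ) : ℂ) ^ (σ + u * Complex.I : ℂ))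
            (fun u : ℝ => Complex.Gamma (((j : ℝ) + 1 : ℝ) + (τ + u * Complex.I)) *
              Complex.Gamma (-(τ + u * Complex.I)) * ((w * y : ℝ) : ℂ) ^ (τ + u * Complex.I : ℂ))
          rw [hs, ht] at hst
          have key : ∫ q : ℝ × ℝ, (Complex.Gamma (((k : ℝ) + 1 : ℝ) + (σ + q.1 * Complex.I)) *
              Complex.Gamma (-(σ + q.1 * Complex.I)) * (x : ℂ) ^ (σ + q.1 * Complex.I : ℂ)) *
              (Complex.Gamma (((j : ℝ) + 1 : ℝ) + (τ + q.2 * Complex.I)) *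
              Complex.Gamma (-(τ + q.2 * Complex.I)) * (y : ℂ) ^ (τ + q.2 * Complex.I : ℂ)) *
              (w : ℂ) ^ (2 + (σ + q.1 * Complex.I) + (τ + q.2 * Complex.I) - 1 : ℂ)
                ∂((volume : Measure ℝ).prod volume) = w * (2 * Real.pi * (k.factorial *
                  ((1 + w * x) ^ (k + 1))⁻¹ : ℝ) * (2 * Real.pi * (j.factorial *
                  ((1 + w * y) ^ (j + 1))⁻¹ : ℝ))) := by
            rw [← hst, ← integral_const_mul]
            congr with q
            rw [hq, ofReal_mul_cpow hw hx, ofReal_mul_cpow hw hy]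
            ring
          rw [key]
          push_cast
          ring
  rw [hint, integral_complex_ofReal, integral_const_mul]
  have hpi : (Real.pi : ℂ) ≠ 0 := Complex.ofReal_ne_zero.2 Real.pi_pos.ne'
  rw [mul_assoc ((2 * Real.pi) ^ 2), Complex.ofReal_mul, ← mul_assoc,
    show 1 / (2 * (Real.pi : ℂ)) ^ 2 * (((2 * Real.pi) ^ 2 : ℝ) : ℂ) = 1 by
      push_cast; field_simp, one_mul]

/-! ### The interference-free capacity -/

/-- The substitution t = a(1+u) in the incomplete gamma integral. -/
theorem exp_mul_upperGamma_eq_tricomiPsi {a : ℝ} (ha : 0 < a) (k : ℕ) :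
    a ^ k * Real.exp a * upperGamma (-(k : ℝ)) a = tricomiPsi 1 (1 - k) a := by
  have h1 : upperGamma (-(k : ℝ)) a =
      ∫ u in Set.Ioi (0 : ℝ), (a + a * u) ^ (-(k : ℝ) - 1) * Real.exp (-(a + a * u)) * a := by
    have := integral_comp_mul_left_Ioi
      (fun t => (a + t) ^ (-(k : ℝ) - 1) * Real.exp (-(a + t))) 0 ha
    rw [integral_mul_const, this, mul_zero, smul_eq_mul, mul_comm, mul_inv_cancel_left₀ ha.ne',
      upperGamma]
    have h := (measurePreserving_add_left volume a).setIntegral_preimage_emb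
      (measurableEmbedding_addLeft a) (fun t => t ^ (-(k : ℝ) - 1) * Real.exp (-t)) (Set.Ioi a)
    rw [Set.preimage_const_add_Ioi, sub_self] at h
    exact h.symm
  rw [h1, tricomiPsi, Real.Gamma_one, inv_one, one_mul, ← integral_const_mul]
  refine setIntegral_congr_fun measurableSet_Ioi fun u (hu : 0 < u) => ?_
  have h2 : (a + a * u) ^ (-(k : ℝ) - 1) = (a ^ (k + 1))⁻¹ * (1 + u) ^ (-(k : ℝ) - 1) := by
    rw [show a + a * u = a * (1 + u) by ring, Real.mul_rpow ha.le (by positivity),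
      show -(k : ℝ) - 1 = -((k + 1 : ℕ) : ℝ) by push_cast; ring, Real.rpow_neg ha.le,
      Real.rpow_natCast]
  have h3 : Real.exp (-(a + a * u)) = (Real.exp a)⁻¹ * Real.exp (-(a * u)) := by
    rw [neg_add, Real.exp_add, Real.exp_neg]
  rw [h2, h3, sub_self, Real.rpow_zero, mul_one, show (1 : ℝ) - k - 1 - 1 = -k - 1 by ring]
  have := Real.exp_pos a
  field_simp
  rw [pow_succ]

theorem integrable_exp_sub_exp_div {a : ℝ} (ha : 0 ≤ a) :
    IntegrableOn (fun z : ℝ => z⁻¹ * (Real.exp (-z) - Real.exp (-((1 + a) * z)))) (Set.Ioi 0) := by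
  have h : IntegrableOn (fun z : ℝ => a * Real.exp (-z)) (Set.Ioi 0) :=
    (integrableOn_exp_neg_Ioi 0).const_mul a
  refine h.mono' (by fun_prop) ?_
  filter_upwards [ae_restrict_mem measurableSet_Ioi] with z (hz : 0 < z)
  have h1 : Real.exp (-((1 + a) * z)) = Real.exp (-z) * Real.exp (-(a * z)) := by
    rw [← Real.exp_add]; ring_nf
  have h2 := Real.add_one_le_exp (-(a * z))
  have h3 : Real.exp (-(a * z)) ≤ 1 := Real.exp_le_one_iff.2 (by nlinarith)
  have h4 := Real.exp_pos (-z)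
  rw [h1, Real.norm_of_nonneg (mul_nonneg (inv_nonneg.2 hz.le) (by nlinarith)),
    inv_mul_le_iff₀ hz]
  nlinarith

theorem integral_exp_sub_exp_div {a : ℝ} (ha : 0 ≤ a) :
    ∫ z in Set.Ioi (0 : ℝ), z⁻¹ * (Real.exp (-z) - Real.exp (-((1 + a) * z))) =
      Real.log (1 + a) := by
  have h := Frullani.integral_Ioi_eq (f := fun x : ℝ => Real.exp (-x)) (a := 1) (b := 1 + a)
    (L := 1) (R := 0)
    ((by fun_prop : Continuous fun x : ℝ => Real.exp (-x)).locallyIntegrable.locallyIntegrableOn _)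
    one_pos (by positivity) ?_ ?_ ?_
  · simpa using h
  · have : Tendsto (fun x : ℝ => Real.exp (-x)) (𝓝 0) (𝓝 (Real.exp (-0))) :=
      (by fun_prop : Continuous fun x : ℝ => Real.exp (-x)).tendsto 0
    rw [neg_zero, Real.exp_zero] at this
    exact this.mono_left nhdsWithin_le_nhds
  · exact Real.tendsto_exp_neg_atTop_nhds_zero
  · simpa using integrable_exp_sub_exp_div ha

theorem log_one_add_mul_div {a b : ℝ} (ha : 0 ≤ a) (hb : 0 ≤ b) :
    Real.log (1 + a * b / (a + b + 1)) =
      Real.log (1 + a) + Real.log (1 + b) - Real.log (1 + (a + b)) := by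
  rw [← Real.log_mul (by positivity) (by positivity), ← Real.log_div (by positivity)
    (by positivity)]
  congr 1
  field_simp
  ring

/-- The kernel is the Frullani integrand for a plus that for b minus that for a + b, matching the
three logarithms. -/
theorem integral_frullani_kernel {a b : ℝ} (ha : 0 ≤ a) (hb : 0 ≤ b) :
    ∫ z in Set.Ioi (0 : ℝ), z⁻¹ * Real.exp (-z) *
      ((1 - Real.exp (-(z * a))) * (1 - Real.exp (-(z * b)))) =
      Real.log (1 + a * b / (a + b + 1)) := by
  have hab : 0 ≤ a + b := by positivity
  have hadd : Integrable (fun z : ℝ => z⁻¹ * (Real.exp (-z) - Real.exp (-((1 + a) * z))) +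
      z⁻¹ * (Real.exp (-z) - Real.exp (-((1 + b) * z)))) (volume.restrict (Set.Ioi 0)) :=
    (integrable_exp_sub_exp_div ha).add (integrable_exp_sub_exp_div hb)
  rw [log_one_add_mul_div ha hb, ← integral_exp_sub_exp_div ha, ← integral_exp_sub_exp_div hb,
    ← integral_exp_sub_exp_div hab, ← integral_add (integrable_exp_sub_exp_div ha)
    (integrable_exp_sub_exp_div hb), ← integral_sub hadd (integrable_exp_sub_exp_div hab)]
  congr with z
  have h : ∀ c, Real.exp (-((1 + c) * z)) = Real.exp (-z) * Real.exp (-(z * c)) := fun c => by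
    rw [← Real.exp_add]; ring_nf
  rw [h, h, h, mul_add z, neg_add, Real.exp_add]
  ring

/-- The bound 1 - e^(-x) ≤ x on the first factor absorbs z⁻¹ and the second factor is at most 1, so
ρ₁‖h₁‖² e^(-z) is an integrable majorant. -/
theorem integrable_frullani_kernel_prod {N : ℕ} {ρ₁ ρ₂ : ℝ} (hρ₁ : 0 ≤ ρ₁) (hρ₂ : 0 ≤ ρ₂) :
    Integrable (fun p : ((Fin N → ℂ) × (Fin N → ℂ)) × ℝ => p.2⁻¹ * Real.exp (-p.2) *
      ((1 - Real.exp (-(p.2 * (ρ₁ * sqNorm p.1.1)))) *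
        (1 - Real.exp (-(p.2 * (ρ₂ * sqNorm p.1.2))))))
      (((vectorLaw N).prod (vectorLaw N)).prod (volume.restrict (Set.Ioi 0))) := by
  have h1 : Integrable (fun h : (Fin N → ℂ) × (Fin N → ℂ) => ρ₁ * sqNorm h.1)
      ((vectorLaw N).prod (vectorLaw N)) := ((integrable_sqNorm N).comp_fst _).const_mul ρ₁
  have h2 : Integrable (fun z : ℝ => Real.exp (-z)) (volume.restrict (Set.Ioi 0)) :=
    integrableOn_exp_neg_Ioi 0
  refine (h1.mul_prod h2).mono' (Measurable.aestronglyMeasurable (by fun_prop)) ?_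
  have : ∀ᵐ p ∂(((vectorLaw N).prod (vectorLaw N)).prod (volume.restrict (Set.Ioi (0 : ℝ)))),
      p.2 ∈ Set.Ioi (0 : ℝ) :=
    Measure.quasiMeasurePreserving_snd.ae (ae_restrict_mem measurableSet_Ioi)
  filter_upwards [this] with p (hp : 0 < p.2)
  have ha : 0 ≤ ρ₁ * sqNorm p.1.1 := mul_nonneg hρ₁ (sqNorm_nonneg _)
  have hb : 0 ≤ ρ₂ * sqNorm p.1.2 := mul_nonneg hρ₂ (sqNorm_nonneg _)
  have ha1 : Real.exp (-(p.2 * (ρ₁ * sqNorm p.1.1))) ≤ 1 :=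
    Real.exp_le_one_iff.2 (by nlinarith)
  have hb1 : Real.exp (-(p.2 * (ρ₂ * sqNorm p.1.2))) ≤ 1 :=
    Real.exp_le_one_iff.2 (by nlinarith)
  have ha2 := Real.add_one_le_exp (-(p.2 * (ρ₁ * sqNorm p.1.1)))
  have hb2 := Real.exp_pos (-(p.2 * (ρ₂ * sqNorm p.1.2)))
  rw [Real.norm_of_nonneg (mul_nonneg (by positivity) (mul_nonneg (by linarith) (by linarith)))]
  calc _ ≤ p.2⁻¹ * Real.exp (-p.2) * ((p.2 * (ρ₁ * sqNorm p.1.1)) * 1) := by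
        gcongr <;> linarith
    _ = _ := by field_simp

theorem integral_log_snrFree {N : ℕ} {ρ₁ ρ₂ : ℝ} (hρ₁ : 0 ≤ ρ₁) (hρ₂ : 0 ≤ ρ₂) :
    ∫ h, Real.log (1 + snrFree ρ₁ ρ₂ h) ∂((vectorLaw N).prod (vectorLaw N)) =
      ∫ z in Set.Ioi (0 : ℝ), z⁻¹ * Real.exp (-z) *
        ((1 - ((1 + z * ρ₁) ^ N)⁻¹) * (1 - ((1 + z * ρ₂) ^ N)⁻¹)) := by
  have hone : ∀ {ρ : ℝ}, 0 ≤ ρ → ∀ {z : ℝ}, 0 < z →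
      ∫ h, (1 - Real.exp (-(z * (ρ * sqNorm h)))) ∂(vectorLaw N) = 1 - ((1 + z * ρ) ^ N)⁻¹ := by
    intro ρ hρ z hz
    have hint : Integrable (fun h => Real.exp (-(z * (ρ * sqNorm h)))) (vectorLaw N) := by
      refine (integrable_const (1 : ℝ)).mono' (Measurable.aestronglyMeasurable (by fun_prop))
        (ae_of_all _ fun h => ?_)
      have := mul_nonneg hz.le (mul_nonneg hρ (sqNorm_nonneg h))
      rw [Real.norm_eq_abs, Real.abs_exp]
      exact Real.exp_le_one_iff.2 (by linarith)
    rw [integral_sub (integrable_const _) hint]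
    simp_rw [← mul_assoc]
    rw [integral_exp_neg_mul_sqNorm N (by positivity)]
    simp
  have : SFinite ((vectorLaw N).prod (vectorLaw N)) := Measure.prod.instSFinite
  calc _ = ∫ h, (∫ z in Set.Ioi (0 : ℝ), z⁻¹ * Real.exp (-z) *
          ((1 - Real.exp (-(z * (ρ₁ * sqNorm h.1)))) * (1 - Real.exp (-(z * (ρ₂ * sqNorm h.2))))))
          ∂((vectorLaw N).prod (vectorLaw N)) := by
        refine integral_congr_ae (ae_of_all _ fun h => ?_)
        exact (integral_frullani_kernel (mul_nonneg hρ₁ (sqNorm_nonneg _))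
          (mul_nonneg hρ₂ (sqNorm_nonneg _))).symm
    _ = ∫ z in Set.Ioi (0 : ℝ), ∫ h, z⁻¹ * Real.exp (-z) *
          ((1 - Real.exp (-(z * (ρ₁ * sqNorm h.1)))) * (1 - Real.exp (-(z * (ρ₂ * sqNorm h.2)))))
          ∂((vectorLaw N).prod (vectorLaw N)) :=
        integral_integral_swap (f := fun (h : (Fin N → ℂ) × (Fin N → ℂ)) (z : ℝ) =>
          z⁻¹ * Real.exp (-z) * ((1 - Real.exp (-(z * (ρ₁ * sqNorm h.1)))) *
            (1 - Real.exp (-(z * (ρ₂ * sqNorm h.2))))))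
          (integrable_frullani_kernel_prod hρ₁ hρ₂)
    _ = _ := by
        refine setIntegral_congr_fun measurableSet_Ioi fun z (hz : 0 < z) => ?_
        rw [integral_const_mul, integral_prod_mul
          (fun h : Fin N → ℂ => 1 - Real.exp (-(z * (ρ₁ * sqNorm h))))
          (fun h : Fin N → ℂ => 1 - Real.exp (-(z * (ρ₂ * sqNorm h)))), hone hρ₁ hz, hone hρ₂ hz]

theorem mul_sum_inv_pow {z ρ : ℝ} (h : 0 < 1 + z * ρ) (N : ℕ) :
    z * ∑ k ∈ Finset.range N, ρ * ((1 + z * ρ) ^ (k + 1))⁻¹ = 1 - ((1 + z * ρ) ^ N)⁻¹ := by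
  induction N with
  | zero => simp
  | succ n ih =>
    rw [Finset.sum_range_succ, mul_add, ih]
    field_simp
    ring

theorem capacityLN_eq {ρ₁ ρ₂ : ℝ} (hρ₁ : 0 < ρ₁) (hρ₂ : 0 < ρ₂) (N : ℕ) :
    capacityLN N ρ₁ ρ₂ = ((1 / (2 * Real.log 2) * ∫ z in Set.Ioi (0 : ℝ), z⁻¹ * Real.exp (-z) *
        ((1 - ((1 + z * ρ₁) ^ N)⁻¹) * (1 - ((1 + z * ρ₂) ^ N)⁻¹)) : ℝ) : ℂ) := by
  have hcancel : ∀ ρ : ℝ, 0 < ρ →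
      ∑ k ∈ Finset.range N, (1 / ρ) ^ k * Real.exp (1 / ρ) * upperGamma (-(k : ℝ)) (1 / ρ) =
        ∑ k ∈ Finset.range N, tricomiPsi 1 (1 - k) (1 / ρ) := fun ρ hρ =>
    Finset.sum_congr rfl fun k _ => exp_mul_upperGamma_eq_tricomiPsi (by positivity) k
  have hint := integrable_mul_exp_neg_mul_inv_pow hρ₁ hρ₂
  have hG : (ρ₁ * ρ₂ * ∑ k ∈ Finset.range N, ∑ j ∈ Finset.range N,
      1 / (Complex.Gamma (k + 1) * Complex.Gamma (j + 1)) *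
        meijerG2 2 (-(k : ℝ)) (-(j : ℝ)) 0 0 ρ₁ ρ₂ : ℂ) =
      ((ρ₁ * ρ₂ * ∑ k ∈ Finset.range N, ∑ j ∈ Finset.range N, ∫ z in Set.Ioi (0 : ℝ),
        z * Real.exp (-z) * ((1 + z * ρ₁) ^ (k + 1))⁻¹ * ((1 + z * ρ₂) ^ (j + 1))⁻¹ : ℝ) : ℂ) := by
    push_cast
    congr 1
    refine Finset.sum_congr rfl fun k _ => Finset.sum_congr rfl fun j _ => ?_
    rw [meijerG2_eq_integral hρ₁ hρ₂, Complex.Gamma_nat_eq_factorial,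
      Complex.Gamma_nat_eq_factorial, Complex.ofReal_mul, ← mul_assoc]
    have hk : (k.factorial : ℂ) ≠ 0 := Nat.cast_ne_zero.2 k.factorial_ne_zero
    have hj : (j.factorial : ℂ) ≠ 0 := Nat.cast_ne_zero.2 j.factorial_ne_zero
    rw [show 1 / ((k.factorial : ℂ) * j.factorial) * ((k.factorial * j.factorial : ℝ) : ℂ) = 1 by
      push_cast; field_simp, one_mul]
  rw [capacityLN, hcancel ρ₁ hρ₁, hcancel ρ₂ hρ₂, hG, add_sub_cancel_left, sub_self,
    Complex.ofReal_zero, zero_add,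
    show 1 / (2 * (Real.log 2 : ℂ)) = ((1 / (2 * Real.log 2) : ℝ) : ℂ) by push_cast; rfl,
    ← Complex.ofReal_mul]
  congr 2
  -- Under the integral the double sum factors into two geometric sums; each absorbs one factor z,
  -- so the weight z e^(-z) becomes z⁻¹ e^(-z).
  have hsum : ∫ z in Set.Ioi (0 : ℝ), ∑ k ∈ Finset.range N, ∑ j ∈ Finset.range N,
      z * Real.exp (-z) * ((1 + z * ρ₁) ^ (k + 1))⁻¹ * ((1 + z * ρ₂) ^ (j + 1))⁻¹ =
      ∑ k ∈ Finset.range N, ∑ j ∈ Finset.range N, ∫ z in Set.Ioi (0 : ℝ),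
        z * Real.exp (-z) * ((1 + z * ρ₁) ^ (k + 1))⁻¹ * ((1 + z * ρ₂) ^ (j + 1))⁻¹ := by
    refine (integral_finsetSum (Finset.range N) fun k _ =>
      integrable_finsetSum (Finset.range N) fun j _ => hint (k + 1) (j + 1)).trans ?_
    refine Finset.sum_congr rfl fun k _ => ?_
    exact integral_finsetSum (Finset.range N) fun j _ => hint (k + 1) (j + 1)
  rw [← hsum, ← integral_const_mul]
  refine setIntegral_congr_fun measurableSet_Ioi fun z (hz : 0 < z) => ?_
  rw [← mul_sum_inv_pow (by positivity) N, ← mul_sum_inv_pow (by positivity) N, mul_mul_mul_comm z,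
    Finset.sum_mul_sum, Finset.mul_sum, Finset.mul_sum, Finset.mul_sum]
  refine Finset.sum_congr rfl fun k _ => ?_
  rw [Finset.mul_sum, Finset.mul_sum, Finset.mul_sum]
  refine Finset.sum_congr rfl fun j _ => ?_
  field_simp

theorem capacityFree_eq_capacityLN {ρ₁ ρ₂ : ℝ} (hρ₁ : 0 < ρ₁) (hρ₂ : 0 < ρ₂) (N : ℕ) :
    (capacityFree N ρ₁ ρ₂ : ℂ) = capacityLN N ρ₁ ρ₂ := by
  rw [capacityLN_eq hρ₁ hρ₂, ← integral_log_snrFree hρ₁.le hρ₂.le, capacityFree,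
    ← integral_const_mul]
  congr 1
  refine integral_congr_ae (ae_of_all _ fun h => ?_)
  simp only [mutualInfo, Real.logb]
  ring

/-! ### Algebra of the end-to-end SINR -/

theorem star_dotProduct_self_eq_sqNorm {N : ℕ} (v : Fin N → ℂ) : star v ⬝ᵥ v = (sqNorm v : ℂ) := by
  simp only [dotProduct, sqNorm, Pi.star_apply, Complex.ofReal_sum]
  refine Finset.sum_congr rfl fun n _ => ?_
  simpa using RCLike.conj_mul (v n)

theorem sqNorm_smul {N : ℕ} (c : ℂ) (v : Fin N → ℂ) : sqNorm (c • v) = ‖c‖ ^ 2 * sqNorm v := by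
  simp [sqNorm, mul_pow, Finset.mul_sum]

theorem sqNorm_star {N : ℕ} (v : Fin N → ℂ) : sqNorm (star v) = sqNorm v := by
  simp [sqNorm]

theorem norm_dotProduct_sq_le {N : ℕ} (w v : Fin N → ℂ) :
    ‖w ⬝ᵥ v‖ ^ 2 ≤ sqNorm w * sqNorm v := by
  have h1 : ‖w ⬝ᵥ v‖ ≤ ∑ n, ‖w n‖ * ‖v n‖ :=
    (norm_sum_le _ _).trans (le_of_eq (Finset.sum_congr rfl fun n _ => norm_mul _ _))
  calc _ ≤ (∑ n, ‖w n‖ * ‖v n‖) ^ 2 := by gcongr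
    _ ≤ _ := Finset.sum_mul_sq_le_sq_mul_sq _ _ _

/-- Interference plus noise power behind the combiner `w`. -/
noncomputable def noisePower {N M : ℕ} (ρI : Fin M → ℝ) (h : Channel N M) (w : Fin N → ℂ) : ℝ :=
  ∑ i, ‖w ⬝ᵥ h.2.2 i‖ ^ 2 * ρI i + sqNorm w

theorem sqNorm_le_noisePower {N M : ℕ} {ρI : Fin M → ℝ} (hρI : ∀ i, 0 ≤ ρI i) (h : Channel N M)
    (w : Fin N → ℂ) : sqNorm w ≤ noisePower ρI h w :=
  le_add_of_nonneg_left (Finset.sum_nonneg fun i _ => mul_nonneg (by positivity) (hρI i))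

theorem noisePower_nonneg {N M : ℕ} {ρI : Fin M → ℝ} (hρI : ∀ i, 0 ≤ ρI i) (h : Channel N M)
    (w : Fin N → ℂ) : 0 ≤ noisePower ρI h w :=
  (sqNorm_nonneg w).trans (sqNorm_le_noisePower hρI h w)

/-- With signal power S and noise power Q behind w, the rank-one relay scales both by ω²‖h₂‖², where
ω² = ρ₂/(S+Q). This is the two-hop formula for first-hop SINR S/Q, cleared of the division by Q so
that it also covers Q = 0. -/
theorem sinr_relayMatrix {N M : ℕ} {ρ₁ ρ₂ : ℝ} {ρI : Fin M → ℝ} (hρ₁ : 0 ≤ ρ₁) (hρ₂ : 0 ≤ ρ₂)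
    (hρI : ∀ i, 0 ≤ ρI i) (h : Channel N M) (w : Fin N → ℂ) :
    sinr ρ₁ ρI h (relayMatrix ρ₁ ρ₂ ρI h w) =
      ρ₂ * sqNorm h.2.1 * (‖w ⬝ᵥ h.1‖ ^ 2 * ρ₁) /
        (ρ₂ * sqNorm h.2.1 * noisePower ρI h w + ‖w ⬝ᵥ h.1‖ ^ 2 * ρ₁ + noisePower ρI h w) := by
  set S := ‖w ⬝ᵥ h.1‖ ^ 2 * ρ₁ with hS
  set Q := noisePower ρI h w with hQ
  set g := sqNorm h.2.1 with hg
  have hS0 : 0 ≤ S := by positivity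
  have hQ0 : 0 ≤ Q := noisePower_nonneg hρI h w
  have hg0 : 0 ≤ g := sqNorm_nonneg _
  have hω : powerFactorSq ρ₁ ρ₂ ρI h w = ρ₂ / (S + Q) := by
    rw [powerFactorSq, hQ, noisePower, ← add_assoc]
  have hω0 : 0 ≤ ρ₂ / (S + Q) := by positivity
  set c : ℝ := √(ρ₂ / (S + Q)) / √g with hc
  have hcg : (c * g) ^ 2 = ρ₂ / (S + Q) * g := by
    rw [mul_pow, hc, div_pow, Real.sq_sqrt hω0, Real.sq_sqrt hg0]
    rcases hg0.eq_or_lt with h0 | h0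
    · simp [← h0]
    · field_simp
  have hW : relayMatrix ρ₁ ρ₂ ρI h w = (c : ℂ) • Matrix.vecMulVec h.2.1 w := by
    rw [relayMatrix, hω]
  have hmul : ∀ v, ‖star h.2.1 ⬝ᵥ (relayMatrix ρ₁ ρ₂ ρI h w).mulVec v‖ ^ 2 =
      ρ₂ / (S + Q) * g * ‖w ⬝ᵥ v‖ ^ 2 := by
    intro v
    rw [hW, Matrix.smul_mulVec, dotProduct_smul, Matrix.vecMulVec_mulVec, dotProduct_smul,
      star_dotProduct_self_eq_sqNorm, ← hcg]
    simp only [smul_eq_mul, MulOpposite.smul_eq_mul_unop, MulOpposite.unop_op, norm_mul,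
      Complex.norm_real, mul_pow, Real.norm_eq_abs, sq_abs]
    ring
  have hvec : sqNorm (Matrix.vecMul (star h.2.1) (relayMatrix ρ₁ ρ₂ ρI h w)) =
      ρ₂ / (S + Q) * g * sqNorm w := by
    rw [hW, Matrix.vecMul_smul, Matrix.vecMul_vecMulVec, star_dotProduct_self_eq_sqNorm, smul_smul,
      sqNorm_smul, ← hcg]
    simp only [norm_mul, Complex.norm_real, mul_pow, Real.norm_eq_abs, sq_abs]
    rfl
  have hden : ∑ i, ‖star h.2.1 ⬝ᵥ (relayMatrix ρ₁ ρ₂ ρI h w).mulVec (h.2.2 i)‖ ^ 2 * ρI i +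
      sqNorm (Matrix.vecMul (star h.2.1) (relayMatrix ρ₁ ρ₂ ρI h w)) =
      ρ₂ / (S + Q) * g * Q := by
    have hmul' := hmul
    rw [hvec]
    generalize ρ₂ / (S + Q) * g = κ at hmul' ⊢
    rw [hQ, noisePower, mul_add, Finset.mul_sum]
    congr 1
    exact Finset.sum_congr rfl fun i _ => by rw [hmul', mul_assoc]
  rw [sinr, hden, hmul, mul_assoc _ _ ρ₁, ← hS]
  -- If S + Q = 0 then S = 0 and both numerators vanish.
  rcases (add_nonneg hS0 hQ0).eq_or_lt with h0 | h0
  · have : S = 0 := by linarith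
    simp [this]
  · have : ρ₂ * g * Q + S + Q = ρ₂ * g * Q + (S + Q) := by ring
    rw [this]
    have : 0 < ρ₂ * g * Q + (S + Q) := by positivity
    field_simp

theorem sinr_relayMatrix_nonneg {N M : ℕ} {ρ₁ ρ₂ : ℝ} {ρI : Fin M → ℝ} (hρ₁ : 0 ≤ ρ₁)
    (hρ₂ : 0 ≤ ρ₂) (hρI : ∀ i, 0 ≤ ρI i) (h : Channel N M) (w : Fin N → ℂ) :
    0 ≤ sinr ρ₁ ρI h (relayMatrix ρ₁ ρ₂ ρI h w) := by
  rw [sinr_relayMatrix hρ₁ hρ₂ hρI]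
  have := noisePower_nonneg hρI h w
  have := sqNorm_nonneg h.2.1
  positivity

theorem sinr_relayMatrix_le_snrFree {N M : ℕ} {ρ₁ ρ₂ : ℝ} {ρI : Fin M → ℝ} (hρ₁ : 0 ≤ ρ₁)
    (hρ₂ : 0 ≤ ρ₂) (hρI : ∀ i, 0 ≤ ρI i) (h : Channel N M) (w : Fin N → ℂ) :
    sinr ρ₁ ρI h (relayMatrix ρ₁ ρ₂ ρI h w) ≤ snrFree ρ₁ ρ₂ (h.1, h.2.1) := by
  rw [sinr_relayMatrix hρ₁ hρ₂ hρI, snrFree]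
  set Q := noisePower ρI h w
  have hQ : 0 ≤ Q := noisePower_nonneg hρI h w
  have hA : 0 ≤ ρ₁ * sqNorm h.1 := mul_nonneg hρ₁ (sqNorm_nonneg _)
  have hB : 0 ≤ ρ₂ * sqNorm h.2.1 := mul_nonneg hρ₂ (sqNorm_nonneg _)
  have hS : ‖w ⬝ᵥ h.1‖ ^ 2 * ρ₁ ≤ ρ₁ * sqNorm h.1 * Q := by
    calc _ ≤ sqNorm w * sqNorm h.1 * ρ₁ := by gcongr; exact norm_dotProduct_sq_le _ _
      _ = ρ₁ * sqNorm h.1 * sqNorm w := by ring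
      _ ≤ _ := by gcongr; exact sqNorm_le_noisePower hρI h w
  have hS0 : 0 ≤ ‖w ⬝ᵥ h.1‖ ^ 2 * ρ₁ := by positivity
  set A := ρ₁ * sqNorm h.1
  set B := ρ₂ * sqNorm h.2.1
  set S := ‖w ⬝ᵥ h.1‖ ^ 2 * ρ₁
  rcases (show 0 ≤ B * Q + S + Q by positivity).eq_or_lt with h0 | h0
  · rw [← h0, div_zero]; positivity
  · rw [div_le_div_iff₀ h0 (by positivity)]
    nlinarith [mul_le_mul_of_nonneg_left hS (show 0 ≤ B * (B + 1) by positivity)]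

/-- Monotonicity of the two-hop formula in the first-hop SINR, of which `a` is a lower bound. The
condition `ha0` is needed because `haQ` says nothing about `a` when the noise power vanishes. -/
theorem le_sinr_relayMatrix {N M : ℕ} {ρ₁ ρ₂ : ℝ} {ρI : Fin M → ℝ} (hρ₁ : 0 ≤ ρ₁)
    (hρ₂ : 0 ≤ ρ₂) (hρI : ∀ i, 0 ≤ ρI i) (h : Channel N M) (w : Fin N → ℂ) {a : ℝ} (ha : 0 ≤ a)
    (haQ : a * noisePower ρI h w ≤ ‖w ⬝ᵥ h.1‖ ^ 2 * ρ₁)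
    (ha0 : noisePower ρI h w = 0 → a = 0) :
    a * (ρ₂ * sqNorm h.2.1) / (a + ρ₂ * sqNorm h.2.1 + 1) ≤
      sinr ρ₁ ρI h (relayMatrix ρ₁ ρ₂ ρI h w) := by
  rw [sinr_relayMatrix hρ₁ hρ₂ hρI]
  have hB : 0 ≤ ρ₂ * sqNorm h.2.1 := mul_nonneg hρ₂ (sqNorm_nonneg _)
  have hS0 : 0 ≤ ‖w ⬝ᵥ h.1‖ ^ 2 * ρ₁ := by positivity
  have hQ : 0 ≤ noisePower ρI h w := noisePower_nonneg hρI h w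
  set Q := noisePower ρI h w
  set B := ρ₂ * sqNorm h.2.1
  set S := ‖w ⬝ᵥ h.1‖ ^ 2 * ρ₁
  rcases hQ.eq_or_lt with h0 | h0
  · rw [ha0 h0.symm]
    simp only [zero_mul, zero_div]
    positivity
  · rw [div_le_div_iff₀ (by positivity) (by positivity)]
    nlinarith [mul_le_mul_of_nonneg_left haQ (show 0 ≤ B * (B + 1) by positivity)]

/-! ### The zero-forcing projection -/

section Projection

variable {N M : ℕ} {H : Matrix (Fin N) (Fin M) ℂ}

theorem zfProjection_isHermitian : (zfProjection H).IsHermitian := by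
  simp [zfProjection, Matrix.IsHermitian, Matrix.conjTranspose_mul,
    Matrix.conjTranspose_nonsing_inv, Matrix.mul_assoc]

theorem zfProjection_mul (hH : (H.conjTranspose * H).det ≠ 0) : zfProjection H * H = 0 := by
  rw [zfProjection, Matrix.sub_mul, Matrix.one_mul, Matrix.mul_assoc,
    Matrix.mul_assoc, Matrix.nonsing_inv_mul _ (isUnit_iff_ne_zero.2 hH), Matrix.mul_one, sub_self]

theorem zfProjection_mul_self (hH : (H.conjTranspose * H).det ≠ 0) :
    zfProjection H * zfProjection H = zfProjection H := by
  conv_lhs => rw [zfProjection.eq_def H]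
  rw [← zfProjection.eq_def H, zfProjection.eq_def H, Matrix.mul_sub, Matrix.mul_one,
    ← zfProjection.eq_def H, ← Matrix.mul_assoc, ← Matrix.mul_assoc, zfProjection_mul hH]
  simp

theorem trace_one_sub_zfProjection (hH : (H.conjTranspose * H).det ≠ 0) :
    (1 - zfProjection H).trace = M := by
  rw [zfProjection, sub_sub_cancel, Matrix.mul_assoc, Matrix.trace_mul_comm, Matrix.mul_assoc,
    Matrix.nonsing_inv_mul _ (isUnit_iff_ne_zero.2 hH), Matrix.trace_one, Fintype.card_fin]

theorem vecMul_star_zfProjection (x : Fin N → ℂ) :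
    Matrix.vecMul (star x) (zfProjection H) = star ((zfProjection H).mulVec x) := by
  rw [Matrix.star_mulVec, zfProjection_isHermitian.eq]

theorem star_dotProduct_zfProjection (hH : (H.conjTranspose * H).det ≠ 0) (x : Fin N → ℂ) :
    star x ⬝ᵥ (zfProjection H).mulVec x = (sqNorm ((zfProjection H).mulVec x) : ℂ) := by
  rw [← star_dotProduct_self_eq_sqNorm, ← vecMul_star_zfProjection, ← Matrix.dotProduct_mulVec,
    Matrix.mulVec_mulVec, zfProjection_mul_self hH]

end Projection

/-- `h₁†P h₁`, the power gain of the zero-forcing combiner. -/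
noncomputable def zfGain {N M : ℕ} (h : Channel N M) : ℝ :=
  (star h.1 ⬝ᵥ (zfProjection (interfererMatrix h.2.2)).mulVec h.1).re

/-- Linear independence of the interferer channels. -/
def NondegenerateInterferers {N M : ℕ} (hI : Fin M → Fin N → ℂ) : Prop :=
  ((interfererMatrix hI).conjTranspose * interfererMatrix hI).det ≠ 0

section Gain

variable {N M : ℕ} {h : Channel N M}

theorem zfGain_eq_sqNorm (hh : NondegenerateInterferers h.2.2) :
    zfGain h = sqNorm ((zfProjection (interfererMatrix h.2.2)).mulVec h.1) := by
  rw [zfGain, star_dotProduct_zfProjection hh, Complex.ofReal_re]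

theorem zfGain_nonneg (hh : NondegenerateInterferers h.2.2) : 0 ≤ zfGain h := by
  rw [zfGain_eq_sqNorm hh]; exact sqNorm_nonneg _

theorem star_zfProjection_dotProduct (hh : NondegenerateInterferers h.2.2) :
    star ((zfProjection (interfererMatrix h.2.2)).mulVec h.1) ⬝ᵥ h.1 = (zfGain h : ℂ) := by
  rw [← vecMul_star_zfProjection, ← Matrix.dotProduct_mulVec, star_dotProduct_zfProjection hh,
    zfGain_eq_sqNorm hh]

theorem dotProduct_zfProjection (hh : NondegenerateInterferers h.2.2) :
    star h.1 ⬝ᵥ (zfProjection (interfererMatrix h.2.2)).mulVec h.1 = (zfGain h : ℂ) := by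
  rw [star_dotProduct_zfProjection hh, zfGain_eq_sqNorm hh]

theorem star_zfProjection_dotProduct_interferer (hh : NondegenerateInterferers h.2.2) (i : Fin M) :
    star ((zfProjection (interfererMatrix h.2.2)).mulVec h.1) ⬝ᵥ h.2.2 i = 0 := by
  have : (zfProjection (interfererMatrix h.2.2)).mulVec (h.2.2 i) = 0 := by
    have := zfProjection_mul hh
    ext n
    exact congrFun (congrFun this n) i
  rw [← vecMul_star_zfProjection, ← Matrix.dotProduct_mulVec, this, dotProduct_zero]

theorem zfGain_le_sqNorm (hh : NondegenerateInterferers h.2.2) : zfGain h ≤ sqNorm h.1 := by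
  have h1 := norm_dotProduct_sq_le
    (star ((zfProjection (interfererMatrix h.2.2)).mulVec h.1)) h.1
  rw [star_zfProjection_dotProduct hh, sqNorm_star, ← zfGain_eq_sqNorm hh, Complex.norm_real,
    Real.norm_eq_abs, sq_abs] at h1
  rcases (zfGain_nonneg hh).eq_or_lt with h0 | h0
  · rw [← h0]; exact sqNorm_nonneg _
  · nlinarith

theorem le_sinrZF {ρ₁ ρ₂ : ℝ} {ρI : Fin M → ℝ} (hρ₁ : 0 ≤ ρ₁) (hρ₂ : 0 ≤ ρ₂)
    (hρI : ∀ i, 0 ≤ ρI i) (hh : NondegenerateInterferers h.2.2) :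
    ρ₁ * zfGain h * (ρ₂ * sqNorm h.2.1) / (ρ₁ * zfGain h + ρ₂ * sqNorm h.2.1 + 1) ≤
      sinrZF ρ₁ ρ₂ ρI h := by
  have hq := zfGain_nonneg hh
  have hw : zfCombiner h = ((1 / √(zfGain h) : ℝ) : ℂ) •
      star ((zfProjection (interfererMatrix h.2.2)).mulVec h.1) := by
    rw [← vecMul_star_zfProjection]; rfl
  have hwI : ∀ i, zfCombiner h ⬝ᵥ h.2.2 i = 0 := fun i => by
    rw [hw, smul_dotProduct, star_zfProjection_dotProduct_interferer hh, smul_zero]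
  have hwh : ‖zfCombiner h ⬝ᵥ h.1‖ ^ 2 = (1 / √(zfGain h)) ^ 2 * zfGain h ^ 2 := by
    rw [hw, smul_dotProduct, star_zfProjection_dotProduct hh, smul_eq_mul, norm_mul, mul_pow,
      Complex.norm_real, Complex.norm_real, Real.norm_eq_abs, Real.norm_eq_abs, sq_abs, sq_abs]
  have hww : sqNorm (zfCombiner h) = (1 / √(zfGain h)) ^ 2 * zfGain h := by
    rw [hw, sqNorm_smul, sqNorm_star, ← zfGain_eq_sqNorm hh, Complex.norm_real, Real.norm_eq_abs,
      sq_abs]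
  have hQ : noisePower ρI h (zfCombiner h) = (1 / √(zfGain h)) ^ 2 * zfGain h := by
    simp [noisePower, hwI, hww]
  refine le_sinr_relayMatrix hρ₁ hρ₂ hρI h _ (by positivity) ?_ ?_
  · rw [hQ, hwh]
    exact le_of_eq (by ring)
  · rw [hQ]
    intro h0
    -- For zero gain the normalisation 1/√0 is 0 and the combiner vanishes, but then the claimed
    -- bound is trivial.
    rcases hq.eq_or_lt with hq0 | hq0
    · rw [← hq0, mul_zero]
    · have : 0 < (1 / √(zfGain h)) ^ 2 * zfGain h := by positivity
      linarith

end Gain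

/-! ### The MMSE combiner -/

section MMSE

variable {N M : ℕ} {h : Channel N M}

/-- `h₁h₁† + H_I H_I† + ε I`. -/
noncomputable def covarianceMatrix (ε : ℝ) (h : Channel N M) : Matrix (Fin N) (Fin N) ℂ :=
  Matrix.vecMulVec h.1 (star h.1) +
    interfererMatrix h.2.2 * (interfererMatrix h.2.2).conjTranspose + (ε : ℂ) • 1

theorem covarianceMatrix_isHermitian (ε : ℝ) : (covarianceMatrix ε h).IsHermitian := by
  simp [covarianceMatrix, Matrix.IsHermitian, Matrix.conjTranspose_mul,
    Matrix.conjTranspose_add, Matrix.conjTranspose_vecMulVec]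

theorem mul_star_eq_norm_sq (z : ℂ) : z * star z = ((‖z‖ ^ 2 : ℝ) : ℂ) := by
  simpa using RCLike.mul_conj z

theorem covarianceMatrix_quadraticForm (ε : ℝ) (x : Fin N → ℂ) :
    star x ⬝ᵥ (covarianceMatrix ε h).mulVec x =
      ((‖star x ⬝ᵥ h.1‖ ^ 2 + ∑ i, ‖star x ⬝ᵥ h.2.2 i‖ ^ 2 + ε * sqNorm x : ℝ) : ℂ) := by
  have h1 : star x ⬝ᵥ (Matrix.vecMulVec h.1 (star h.1)).mulVec x =
      ((‖star x ⬝ᵥ h.1‖ ^ 2 : ℝ) : ℂ) := by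
    rw [Matrix.vecMulVec_mulVec, dotProduct_smul, ← mul_star_eq_norm_sq, ← Matrix.star_dotProduct_star,
      star_star]
    rfl
  have h2 : star x ⬝ᵥ (interfererMatrix h.2.2 * (interfererMatrix h.2.2).conjTranspose).mulVec x =
      ((∑ i, ‖star x ⬝ᵥ h.2.2 i‖ ^ 2 : ℝ) : ℂ) := by
    rw [← Matrix.mulVec_mulVec, Matrix.dotProduct_mulVec, Complex.ofReal_sum, dotProduct]
    refine Finset.sum_congr rfl fun i _ => ?_
    have ha : Matrix.vecMul (star x) (interfererMatrix h.2.2) i = star x ⬝ᵥ h.2.2 i := rfl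
    have hb : (interfererMatrix h.2.2).conjTranspose.mulVec x i = star (star x ⬝ᵥ h.2.2 i) := by
      rw [← Matrix.star_dotProduct_star, star_star]
      rfl
    rw [ha, hb, mul_star_eq_norm_sq]
  rw [covarianceMatrix, Matrix.add_mulVec, Matrix.add_mulVec, dotProduct_add, dotProduct_add, h1,
    h2, Matrix.smul_mulVec, Matrix.one_mulVec, dotProduct_smul, star_dotProduct_self_eq_sqNorm]
  push_cast
  rfl

theorem covarianceMatrix_det_ne_zero {ε : ℝ} (hε : 0 < ε) : (covarianceMatrix ε h).det ≠ 0 := by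
  intro h0
  obtain ⟨x, hx, hx0⟩ := Matrix.exists_mulVec_eq_zero_iff.2 h0
  have h1 := covarianceMatrix_quadraticForm (h := h) ε x
  rw [hx0, dotProduct_zero, eq_comm, Complex.ofReal_eq_zero] at h1
  have h2 : sqNorm x ≤ 0 := by
    have : 0 ≤ ∑ i, ‖star x ⬝ᵥ h.2.2 i‖ ^ 2 := Finset.sum_nonneg fun _ _ => by positivity
    have : 0 ≤ ‖star x ⬝ᵥ h.1‖ ^ 2 := by positivity
    nlinarith
  refine hx (funext fun n => ?_)
  have h3 := (Finset.sum_eq_zero_iff_of_nonneg fun n _ => by positivity).1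
    (le_antisymm h2 (sqNorm_nonneg x)) n (Finset.mem_univ n)
  simpa using h3

/-- For C the covariance matrix, u = C⁻¹h₁ and v = Ph₁ one has v†Cv = q(q+ε), u†Cv = q and u†Cu = α.
The form of C at v - (q+ε)u is therefore (q+ε)((q+ε)α - q), and it is nonnegative. The multiple q +
ε makes this factor come out, with no division by q or α. -/
theorem le_mul_of_covarianceMatrix_mulVec_eq {ε q α : ℝ} {u v : Fin N → ℂ} (hq : 0 ≤ q)
    (hε : 0 < ε) (hu : (covarianceMatrix ε h).mulVec u = h.1) (huh : star u ⬝ᵥ h.1 = (α : ℂ))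
    (hvh : star v ⬝ᵥ h.1 = (q : ℂ)) (hhv : star h.1 ⬝ᵥ v = (q : ℂ))
    (hvi : ∀ i, star v ⬝ᵥ h.2.2 i = 0) (hvs : sqNorm v = q) : q ≤ (q + ε) * α := by
  have hvv : star v ⬝ᵥ (covarianceMatrix ε h).mulVec v = ((q ^ 2 + ε * q : ℝ) : ℂ) := by
    rw [covarianceMatrix_quadraticForm, hvh, hvs, Complex.norm_real, Real.norm_eq_abs, sq_abs]
    simp [hvi]
  have huv : star u ⬝ᵥ (covarianceMatrix ε h).mulVec v = (q : ℂ) := by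
    rw [Matrix.dotProduct_mulVec, ← (covarianceMatrix_isHermitian ε).eq, ← Matrix.star_mulVec,
      hu, hhv]
  have hx := covarianceMatrix_quadraticForm (h := h) ε (v - ((q + ε : ℝ) : ℂ) • u)
  set x := v - ((q + ε : ℝ) : ℂ) • u with hxdef
  have hx1 : star x ⬝ᵥ (covarianceMatrix ε h).mulVec x =
      (((q ^ 2 + ε * q) - (q + ε) * q - ((q + ε) * q - (q + ε) * ((q + ε) * α)) : ℝ) : ℂ) := by
    rw [hxdef, Matrix.mulVec_sub, Matrix.mulVec_smul, star_sub, star_smul, sub_dotProduct,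
      dotProduct_sub, dotProduct_sub, smul_dotProduct, smul_dotProduct, dotProduct_smul,
      dotProduct_smul, hvv, huv, hu, hvh, huh]
    simp
  rw [hx1, Complex.ofReal_inj] at hx
  have h1 : 0 ≤ ∑ i, ‖star x ⬝ᵥ h.2.2 i‖ ^ 2 := Finset.sum_nonneg fun _ _ => by positivity
  have h2 : 0 ≤ ‖star x ⬝ᵥ h.1‖ ^ 2 := by positivity
  have h3 : 0 ≤ ε * sqNorm x := mul_nonneg hε.le (sqNorm_nonneg x)
  have h4 : 0 ≤ (q + ε) * ((q + ε) * α - q) := by linarith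
  linarith [(mul_nonneg_iff_of_pos_left (by positivity : 0 < q + ε)).1 h4]

/-- With α = h₁†C⁻¹h₁ the signal power is ρ₁α² and the noise power ρI(α - α²). That the first-hop
SINR is at least ρ₁q then follows from q ≤ (q + 1/ρI)α. -/
theorem le_sinrMMSE {ρ₁ ρ₂ ρI : ℝ} (hρ₁ : 0 ≤ ρ₁) (hρ₂ : 0 ≤ ρ₂) (hρI : 0 < ρI)
    (hh : NondegenerateInterferers h.2.2) :
    ρ₁ * zfGain h * (ρ₂ * sqNorm h.2.1) / (ρ₁ * zfGain h + ρ₂ * sqNorm h.2.1 + 1) ≤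
      sinrMMSE ρ₁ ρ₂ ρI h := by
  have hq := zfGain_nonneg hh
  set ε : ℝ := 1 / ρI with hε
  have hε0 : 0 < ε := by positivity
  set C := covarianceMatrix ε h with hC
  have hCu := isUnit_iff_ne_zero.2 (covarianceMatrix_det_ne_zero (h := h) hε0)
  set u := C⁻¹.mulVec h.1 with hu
  have hCmul : C.mulVec u = h.1 := by
    rw [hu, Matrix.mulVec_mulVec, Matrix.mul_nonsing_inv _ hCu, Matrix.one_mulVec]
  have hw : mmseCombiner ρI h = star u := by
    rw [hu, Matrix.star_mulVec, (covarianceMatrix_isHermitian ε).inv.eq]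
    rfl
  have hform := covarianceMatrix_quadraticForm (h := h) ε u
  set α : ℝ := ‖star u ⬝ᵥ h.1‖ ^ 2 + ∑ i, ‖star u ⬝ᵥ h.2.2 i‖ ^ 2 + ε * sqNorm u with hα
  have huh : star u ⬝ᵥ h.1 = (α : ℂ) := by rw [← hform, ← hC, hCmul]
  have hα0 : 0 ≤ α := by
    have := sqNorm_nonneg u
    have : 0 ≤ ∑ i, ‖star u ⬝ᵥ h.2.2 i‖ ^ 2 := Finset.sum_nonneg fun _ _ => by positivity
    positivity
  have hnorm : ‖star u ⬝ᵥ h.1‖ ^ 2 = α ^ 2 := by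
    rw [huh, Complex.norm_real, Real.norm_eq_abs, sq_abs]
  have hQ : noisePower (fun _ => ρI) h (star u) = ρI * (α - α ^ 2) := by
    have : ρI * ε = 1 := by rw [hε]; field_simp
    rw [noisePower, sqNorm_star, ← Finset.sum_mul]
    rw [hnorm] at hα
    linear_combination (-ρI) * hα - sqNorm u * this
  have hkey : zfGain h ≤ (zfGain h + ε) * α :=
    le_mul_of_covarianceMatrix_mulVec_eq hq hε0 hCmul huh (star_zfProjection_dotProduct hh)
      (dotProduct_zfProjection hh) (star_zfProjection_dotProduct_interferer hh)
      (zfGain_eq_sqNorm hh).symm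
  have hkey' : ρI * zfGain h ≤ ρI * zfGain h * α + α := by
    have : ρI * ε = 1 := by rw [hε]; field_simp
    nlinarith
  rw [sinrMMSE, hw]
  refine le_sinr_relayMatrix hρ₁ hρ₂ (fun _ => hρI.le) h _ (by positivity) ?_ ?_
  · rw [hQ, hnorm]
    have h1 : 0 ≤ α * (ρI * zfGain h * α + α - ρI * zfGain h) :=
      mul_nonneg hα0 (by linarith)
    nlinarith [mul_nonneg hρ₁ h1]
  · intro h0
    have h1 := norm_dotProduct_sq_le (star u) h.1
    have h2 := sqNorm_le_noisePower (fun _ => hρI.le) h (star u)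
    rw [h0] at h2
    rw [le_antisymm h2 (sqNorm_nonneg _), zero_mul, hnorm] at h1
    have h3 : α = 0 := by nlinarith
    rw [h3, mul_zero] at hkey
    rw [le_antisymm hkey hq, mul_zero]

end MMSE

/-! ### Measurability -/

section Measurability

variable {Ω : Type*} [MeasurableSpace Ω] {n m l : Type*}

theorem measurable_dotProduct [Fintype n] {v w : Ω → n → ℂ} (hv : ∀ i, Measurable fun ω => v ω i)
    (hw : ∀ i, Measurable fun ω => w ω i) : Measurable fun ω => v ω ⬝ᵥ w ω := by
  unfold dotProduct
  exact Finset.measurable_fun_sum _ fun i _ => (hv i).mul (hw i)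

theorem measurable_mul_apply [Fintype m] {A : Ω → Matrix n m ℂ} {B : Ω → Matrix m l ℂ}
    (hA : ∀ i j, Measurable fun ω => A ω i j) (hB : ∀ i j, Measurable fun ω => B ω i j)
    (i : n) (j : l) : Measurable fun ω => (A ω * B ω) i j := by
  simp only [Matrix.mul_apply]
  exact Finset.measurable_fun_sum _ fun k _ => (hA i k).mul (hB k j)

theorem measurable_conjTranspose_apply {A : Ω → Matrix n m ℂ}
    (hA : ∀ i j, Measurable fun ω => A ω i j) (i : m) (j : n) :
    Measurable fun ω => (A ω).conjTranspose i j := by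
  simp only [Matrix.conjTranspose_apply]
  exact (continuous_star.measurable).comp (hA j i)

theorem measurable_det [Fintype n] [DecidableEq n] {A : Ω → Matrix n n ℂ}
    (hA : ∀ i j, Measurable fun ω => A ω i j) : Measurable fun ω => (A ω).det := by
  simp only [Matrix.det_apply']
  exact Finset.measurable_fun_sum _ fun σ _ =>
    measurable_const.mul (Finset.measurable_fun_prod _ fun i _ => hA _ _)

/-- Cramer's formula: determinant and cofactors are polynomials in the entries, and inversion of
scalars is measurable even through 0. -/
theorem measurable_inv_apply [Fintype n] [DecidableEq n] {A : Ω → Matrix n n ℂ}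
    (hA : ∀ i j, Measurable fun ω => A ω i j) (i j : n) :
    Measurable fun ω => (A ω)⁻¹ i j := by
  simp only [Matrix.inv_def, Matrix.smul_apply, Ring.inverse_eq_inv', Matrix.adjugate_apply,
    smul_eq_mul]
  refine (measurable_det hA).inv.mul (measurable_det fun k l => ?_)
  by_cases hk : k = j
  · subst hk; simp
  · simpa [Matrix.updateRow_ne hk] using hA k l

theorem measurable_mulVec_apply [Fintype m] {A : Ω → Matrix n m ℂ} {v : Ω → m → ℂ}
    (hA : ∀ i j, Measurable fun ω => A ω i j) (hv : ∀ i, Measurable fun ω => v ω i) (i : n) :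
    Measurable fun ω => (A ω).mulVec (v ω) i :=
  measurable_dotProduct (hA i) hv

theorem measurable_vecMul_apply [Fintype n] {A : Ω → Matrix n m ℂ} {v : Ω → n → ℂ}
    (hA : ∀ i j, Measurable fun ω => A ω i j) (hv : ∀ i, Measurable fun ω => v ω i) (j : m) :
    Measurable fun ω => Matrix.vecMul (v ω) (A ω) j :=
  measurable_dotProduct hv fun i => hA i j

end Measurability

section ChannelMeasurability

variable {N M : ℕ}

theorem measurable_sinr_relayMatrix {ρ₁ ρ₂ : ℝ} {ρI : Fin M → ℝ} (hρ₁ : 0 ≤ ρ₁) (hρ₂ : 0 ≤ ρ₂)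
    (hρI : ∀ i, 0 ≤ ρI i) {w : Channel N M → Fin N → ℂ}
    (hw : ∀ n, Measurable fun h => w h n) :
    Measurable fun h => sinr ρ₁ ρI h (relayMatrix ρ₁ ρ₂ ρI h (w h)) := by
  simp_rw [sinr_relayMatrix hρ₁ hρ₂ hρI]
  have h1 : Measurable fun h : Channel N M => ‖w h ⬝ᵥ h.1‖ ^ 2 * ρ₁ :=
    ((measurable_dotProduct hw fun i => by fun_prop).norm.pow_const 2).mul_const _
  have h2 : Measurable fun h : Channel N M => noisePower ρI h (w h) := by
    refine (Finset.measurable_fun_sum _ fun i _ => ?_).add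
      (measurable_sqNorm.comp (measurable_pi_iff.2 hw))
    exact ((measurable_dotProduct hw fun i => by fun_prop).norm.pow_const 2).mul_const _
  fun_prop

theorem measurable_zfProjection_apply (i j : Fin N) :
    Measurable fun hI : Fin M → Fin N → ℂ => zfProjection (interfererMatrix hI) i j := by
  have hH : ∀ i j, Measurable fun hI : Fin M → Fin N → ℂ => interfererMatrix hI i j :=
    fun i j => show Measurable fun hI : Fin M → Fin N → ℂ => hI j i by fun_prop
  simp only [zfProjection, Matrix.sub_apply]
  exact measurable_const.sub (measurable_mul_apply (measurable_mul_apply hH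
    (measurable_inv_apply (measurable_mul_apply (measurable_conjTranspose_apply hH) hH)))
    (measurable_conjTranspose_apply hH) i j)

theorem measurable_zfGain : Measurable (zfGain : Channel N M → ℝ) := by
  refine Complex.measurable_re.comp (measurable_dotProduct (fun i => ?_) fun i => ?_)
  · exact continuous_star.measurable.comp (by fun_prop)
  · exact measurable_mulVec_apply (fun i j => (measurable_zfProjection_apply i j).comp
      (by fun_prop : Measurable fun h : Channel N M => h.2.2)) (fun i => by fun_prop) i

theorem measurableSet_nondegenerateInterferers :
    MeasurableSet {hI : Fin M → Fin N → ℂ | NondegenerateInterferers hI} := by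
  have hH : ∀ i j, Measurable fun hI : Fin M → Fin N → ℂ => interfererMatrix hI i j :=
    fun i j => show Measurable fun hI : Fin M → Fin N → ℂ => hI j i by fun_prop
  exact (measurable_det (measurable_mul_apply (measurable_conjTranspose_apply hH) hH))
    (MeasurableSet.singleton (0 : ℂ)).compl

theorem measurable_sinrZF {ρ₁ ρ₂ : ℝ} {ρI : Fin M → ℝ} (hρ₁ : 0 ≤ ρ₁) (hρ₂ : 0 ≤ ρ₂)
    (hρI : ∀ i, 0 ≤ ρI i) :
    Measurable fun h : Channel N M => sinrZF ρ₁ ρ₂ ρI h := by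
  refine measurable_sinr_relayMatrix hρ₁ hρ₂ hρI fun n => ?_
  have h1 : Measurable fun h : Channel N M => ((1 / √(zfGain h) : ℝ) : ℂ) :=
    Complex.measurable_ofReal.comp (measurable_const.div measurable_zfGain.sqrt)
  refine h1.mul (measurable_vecMul_apply (fun i j => (measurable_zfProjection_apply i j).comp
      (by fun_prop : Measurable fun h : Channel N M => h.2.2)) (fun i => ?_) n)
  exact continuous_star.measurable.comp (by fun_prop)

theorem measurable_sinrMMSE {ρ₁ ρ₂ ρI : ℝ} (hρ₁ : 0 ≤ ρ₁) (hρ₂ : 0 ≤ ρ₂) (hρI : 0 ≤ ρI) :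
    Measurable fun h : Channel N M => sinrMMSE ρ₁ ρ₂ ρI h := by
  refine measurable_sinr_relayMatrix hρ₁ hρ₂ (fun _ => hρI) fun n => ?_
  have hstar : ∀ i, Measurable fun h : Channel N M => star h.1 i := fun i =>
    continuous_star.measurable.comp (by fun_prop : Measurable fun h : Channel N M => h.1 i)
  have hH : ∀ i j, Measurable fun h : Channel N M => interfererMatrix h.2.2 i j :=
    fun i j => show Measurable fun h : Channel N M => h.2.2 j i by fun_prop
  refine measurable_vecMul_apply (measurable_inv_apply fun i j => ?_) hstar n
  simp only [Matrix.add_apply]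
  refine Measurable.add (Measurable.add ?_ (measurable_mul_apply hH
    (measurable_conjTranspose_apply hH) i j)) measurable_const
  exact (by fun_prop : Measurable fun h : Channel N M => h.1 i).mul (hstar j)

end ChannelMeasurability

/-! ### Integrability of the mutual information -/

theorem mutualInfo_mono {a b : ℝ} (ha : 0 ≤ a) (hab : a ≤ b) : mutualInfo a ≤ mutualInfo b := by
  unfold mutualInfo
  have := Real.logb_le_logb_of_le (b := 2) (by norm_num) (by linarith : 0 < 1 + a)
    (by linarith : 1 + a ≤ 1 + b)
  linarith

theorem mutualInfo_nonneg {a : ℝ} (ha : 0 ≤ a) : 0 ≤ mutualInfo a := by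
  have := Real.logb_nonneg (b := 2) (by norm_num) (by linarith : 1 ≤ 1 + a)
  unfold mutualInfo
  positivity

theorem mutualInfo_eq (a : ℝ) : mutualInfo a = (2 * Real.log 2)⁻¹ * Real.log (1 + a) := by
  unfold mutualInfo Real.logb
  rw [mul_inv]
  ring

theorem mutualInfo_le {a : ℝ} (ha : 0 ≤ a) : mutualInfo a ≤ (2 * Real.log 2)⁻¹ * a := by
  have h2 : 0 < Real.log 2 := Real.log_pos (by norm_num)
  rw [mutualInfo_eq]
  gcongr
  linarith [Real.log_le_sub_one_of_pos (by linarith : 0 < 1 + a)]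

@[fun_prop]
theorem measurable_mutualInfo : Measurable mutualInfo := by
  have : mutualInfo = fun a => (2 * Real.log 2)⁻¹ * Real.log (1 + a) := funext mutualInfo_eq
  rw [this]
  fun_prop

section Free

variable {N : ℕ} {ρ₁ ρ₂ : ℝ}

theorem snrFree_nonneg (hρ₁ : 0 ≤ ρ₁) (hρ₂ : 0 ≤ ρ₂) (h : (Fin N → ℂ) × (Fin N → ℂ)) :
    0 ≤ snrFree ρ₁ ρ₂ h := by
  have := sqNorm_nonneg h.1
  have := sqNorm_nonneg h.2
  unfold snrFree
  positivity

theorem snrFree_le (hρ₁ : 0 ≤ ρ₁) (hρ₂ : 0 ≤ ρ₂) (h : (Fin N → ℂ) × (Fin N → ℂ)) :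
    snrFree ρ₁ ρ₂ h ≤ ρ₁ * sqNorm h.1 := by
  have hA : 0 ≤ ρ₁ * sqNorm h.1 := mul_nonneg hρ₁ (sqNorm_nonneg _)
  have hB : 0 ≤ ρ₂ * sqNorm h.2 := mul_nonneg hρ₂ (sqNorm_nonneg _)
  rw [snrFree, div_le_iff₀ (by positivity)]
  nlinarith

theorem measurable_snrFree :
    Measurable fun h : (Fin N → ℂ) × (Fin N → ℂ) => snrFree ρ₁ ρ₂ h := by
  unfold snrFree
  fun_prop

theorem integrable_mutualInfo_snrFree (hρ₁ : 0 ≤ ρ₁) (hρ₂ : 0 ≤ ρ₂) :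
    Integrable (fun h => mutualInfo (snrFree ρ₁ ρ₂ h)) ((vectorLaw N).prod (vectorLaw N)) := by
  have h1 : Integrable (fun h : (Fin N → ℂ) × (Fin N → ℂ) => (2 * Real.log 2)⁻¹ *
      (ρ₁ * sqNorm h.1)) ((vectorLaw N).prod (vectorLaw N)) :=
    (((integrable_sqNorm N).comp_fst _).const_mul ρ₁).const_mul _
  have h2 : 0 < Real.log 2 := Real.log_pos (by norm_num)
  refine h1.mono' (measurable_mutualInfo.comp measurable_snrFree).aestronglyMeasurable
    (ae_of_all _ fun h => ?_)
  have h0 := snrFree_nonneg hρ₁ hρ₂ h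
  rw [Real.norm_of_nonneg (mutualInfo_nonneg h0)]
  refine (mutualInfo_le h0).trans ?_
  gcongr
  exact snrFree_le hρ₁ hρ₂ h

theorem measurePreserving_channelLaw (N M : ℕ) :
    MeasurePreserving (fun h : Channel N M => (h.1, h.2.1)) (channelLaw N M)
      ((vectorLaw N).prod (vectorLaw N)) :=
  (MeasurePreserving.id (vectorLaw N)).prod measurePreserving_fst

theorem integrable_mutualInfo_of_le_snrFree {M : ℕ} (hρ₁ : 0 ≤ ρ₁) (hρ₂ : 0 ≤ ρ₂)
    {X : Channel N M → ℝ} (hX : Measurable X) (h0 : ∀ h, 0 ≤ X h)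
    (hle : ∀ h, X h ≤ snrFree ρ₁ ρ₂ (h.1, h.2.1)) :
    Integrable (fun h => mutualInfo (X h)) (channelLaw N M) := by
  have h1 := (measurePreserving_channelLaw N M).integrable_comp_of_integrable
    (integrable_mutualInfo_snrFree (N := N) hρ₁ hρ₂)
  refine h1.mono' (measurable_mutualInfo.comp hX).aestronglyMeasurable (ae_of_all _ fun h => ?_)
  rw [Real.norm_of_nonneg (mutualInfo_nonneg (h0 h))]
  exact mutualInfo_mono (h0 h) (hle h)

end Free

/-! ### Near-orthogonality of the interferer channels -/

section Interferers

variable {N M : ℕ}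

/-- A random variable of small mean dominating the indicator of linearly dependent interferer
channels. -/
noncomputable def dependenceBound (hI : Fin M → Fin N → ℂ) : ℝ :=
  ∑ i, (Real.exp (N / 2) * Real.exp (-(1 * sqNorm (hI i))) +
    ∑ j, if i = j then 0 else 4 * (M : ℝ) ^ 2 / (N : ℝ) ^ 2 * ‖star (hI i) ⬝ᵥ hI j‖ ^ 2)

theorem dependenceBound_nonneg (hI : Fin M → Fin N → ℂ) : 0 ≤ dependenceBound hI := by
  refine Finset.sum_nonneg fun i _ => add_nonneg (by positivity) (Finset.sum_nonneg fun j _ => ?_)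
  split_ifs <;> positivity

/-- If the bound is below 1, the exponential term forces ‖h_i‖² > N/2 and each off-diagonal term
forces |h_i†h_j| ≤ N/(2M), whence the constant 4M²/N². The Gram matrix is then strictly diagonally
dominant, hence invertible. -/
theorem one_le_dependenceBound {hI : Fin M → Fin N → ℂ} (hN : 0 < N)
    (hd : ¬ NondegenerateInterferers hI) : 1 ≤ dependenceBound hI := by
  by_contra! hlt
  refine hd (det_ne_zero_of_sum_row_lt_diag fun i => ?_)
  have hM : 0 < M := i.pos
  have hN' : (0 : ℝ) < N := Nat.cast_pos.2 hN
  have hM' : (0 : ℝ) < M := Nat.cast_pos.2 hM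
  have hentry : ∀ i j, ((interfererMatrix hI).conjTranspose * interfererMatrix hI) i j =
      star (hI i) ⬝ᵥ hI j := fun i j => rfl
  have hnn : ∀ i j, 0 ≤ (if i = j then 0 else
      4 * (M : ℝ) ^ 2 / (N : ℝ) ^ 2 * ‖star (hI i) ⬝ᵥ hI j‖ ^ 2) := by
    intro i j
    split_ifs <;> positivity
  have hrow : Real.exp (N / 2) * Real.exp (-(1 * sqNorm (hI i))) +
      ∑ j, (if i = j then 0 else
        4 * (M : ℝ) ^ 2 / (N : ℝ) ^ 2 * ‖star (hI i) ⬝ᵥ hI j‖ ^ 2) < 1 := by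
    refine lt_of_le_of_lt ?_ hlt
    exact Finset.single_le_sum (f := fun i => Real.exp (N / 2) * Real.exp (-(1 * sqNorm (hI i))) +
      ∑ j, (if i = j then 0 else 4 * (M : ℝ) ^ 2 / (N : ℝ) ^ 2 * ‖star (hI i) ⬝ᵥ hI j‖ ^ 2))
      (fun k _ => add_nonneg (by positivity) (Finset.sum_nonneg fun j _ => hnn k j))
      (Finset.mem_univ i)
  have hdiag : (N : ℝ) / 2 < sqNorm (hI i) := by
    have h1 : Real.exp (N / 2 + -(1 * sqNorm (hI i))) < 1 := by
      rw [Real.exp_add]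
      exact lt_of_le_of_lt (le_add_of_nonneg_right (Finset.sum_nonneg fun j _ => hnn i j)) hrow
    have := Real.exp_lt_one_iff.1 h1
    linarith
  have hoff : ∀ j ∈ Finset.univ.erase i, ‖star (hI i) ⬝ᵥ hI j‖ ≤ N / (2 * M) := by
    intro j hj
    have hne : i ≠ j := (Finset.ne_of_mem_erase hj).symm
    have h1 := Finset.single_le_sum (f := fun j => if i = j then 0 else
      4 * (M : ℝ) ^ 2 / (N : ℝ) ^ 2 * ‖star (hI i) ⬝ᵥ hI j‖ ^ 2) (fun j _ => hnn i j)
      (Finset.mem_univ j)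
    simp only [if_neg hne] at h1
    have h2 : 4 * (M : ℝ) ^ 2 / (N : ℝ) ^ 2 * ‖star (hI i) ⬝ᵥ hI j‖ ^ 2 ≤ 1 := by
      have : 0 ≤ Real.exp (N / 2) * Real.exp (-(1 * sqNorm (hI i))) := by positivity
      linarith
    have h3 : (2 * M / N * ‖star (hI i) ⬝ᵥ hI j‖) ^ 2 ≤ 1 := by
      calc _ = 4 * (M : ℝ) ^ 2 / (N : ℝ) ^ 2 * ‖star (hI i) ⬝ᵥ hI j‖ ^ 2 := by ring
        _ ≤ 1 := h2
    have h4 := (sq_le_one_iff₀ (by positivity)).1 h3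
    rw [le_div_iff₀ (by positivity)]
    rw [div_mul_eq_mul_div, div_le_one hN'] at h4
    linarith
  simp only [hentry]
  rw [star_dotProduct_self_eq_sqNorm, Complex.norm_real, Real.norm_of_nonneg (sqNorm_nonneg _)]
  calc _ ≤ ∑ j ∈ Finset.univ.erase i, (N : ℝ) / (2 * M) := Finset.sum_le_sum hoff
    _ ≤ M * ((N : ℝ) / (2 * M)) := by
        rw [Finset.sum_const, nsmul_eq_mul]
        gcongr
        exact (Finset.card_erase_le).trans (by simp)
    _ = N / 2 := by field_simp
    _ < _ := hdiag

theorem measurePreserving_eval_pair {i j : Fin M} (hij : i ≠ j) :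
    MeasurePreserving (fun hI : Fin M → Fin N → ℂ => (hI i, hI j))
      (Measure.pi fun _ => vectorLaw N) ((vectorLaw N).prod (vectorLaw N)) := by
  refine ⟨by fun_prop, ?_⟩
  have hind := (iIndepFun_pi (μ := fun _ : Fin M => vectorLaw N) (X := fun _ z => z)
    fun _ => aemeasurable_id).indepFun hij
  have h := (indepFun_iff_map_prod_eq_prod_map_map (measurable_pi_apply i).aemeasurable
    (measurable_pi_apply j).aemeasurable).1 hind
  have hi : Measure.map (fun hI : Fin M → Fin N → ℂ => hI i) (Measure.pi fun _ => vectorLaw N) =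
      vectorLaw N := (measurePreserving_eval (fun _ : Fin M => vectorLaw N) i).map_eq
  have hj : Measure.map (fun hI : Fin M → Fin N → ℂ => hI j) (Measure.pi fun _ => vectorLaw N) =
      vectorLaw N := (measurePreserving_eval (fun _ : Fin M => vectorLaw N) j).map_eq
  rw [hi, hj] at h
  exact h

theorem measurable_norm_star_dotProduct_sq :
    Measurable fun p : (Fin N → ℂ) × (Fin N → ℂ) => ‖star p.1 ⬝ᵥ p.2‖ ^ 2 :=
  (measurable_dotProduct (fun i => continuous_star.measurable.comp
    (by fun_prop : Measurable fun p : (Fin N → ℂ) × (Fin N → ℂ) => p.1 i))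
    fun i => by fun_prop).norm.pow_const 2

theorem integrable_norm_star_dotProduct_sq :
    Integrable (fun p : (Fin N → ℂ) × (Fin N → ℂ) => ‖star p.1 ⬝ᵥ p.2‖ ^ 2)
      ((vectorLaw N).prod (vectorLaw N)) := by
  refine ((integrable_sqNorm N).mul_prod (integrable_sqNorm N)).mono'
    measurable_norm_star_dotProduct_sq.aestronglyMeasurable (ae_of_all _ fun p => ?_)
  rw [Real.norm_of_nonneg (by positivity)]
  simpa only [sqNorm_star] using norm_dotProduct_sq_le (star p.1) p.2

theorem integral_norm_star_dotProduct_sq :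
    ∫ p : (Fin N → ℂ) × (Fin N → ℂ), ‖star p.1 ⬝ᵥ p.2‖ ^ 2
      ∂((vectorLaw N).prod (vectorLaw N)) = N := by
  -- For fixed x this is the mean of the quadratic form of xx†, whose trace is ‖x‖².
  have hinner : ∀ x : Fin N → ℂ, ∫ y, ‖star x ⬝ᵥ y‖ ^ 2 ∂(vectorLaw N) = sqNorm x := by
    intro x
    have hform : ∀ y : Fin N → ℂ, ((‖star x ⬝ᵥ y‖ ^ 2 : ℝ) : ℂ) =
        star y ⬝ᵥ (Matrix.vecMulVec x (star x)).mulVec y := by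
      intro y
      rw [Matrix.vecMulVec_mulVec, dotProduct_smul, ← mul_star_eq_norm_sq,
        ← Matrix.star_dotProduct_star, star_star, mul_comm]
      rfl
    apply Complex.ofReal_injective
    rw [← integral_complex_ofReal]
    simp_rw [hform]
    rw [integral_quadraticForm, Matrix.trace_vecMulVec, dotProduct_comm,
      star_dotProduct_self_eq_sqNorm]
  rw [integral_prod _ integrable_norm_star_dotProduct_sq]
  simp_rw [hinner]
  exact integral_sqNorm N

theorem integrable_exp_neg_sqNorm :
    Integrable (fun h : Fin N → ℂ => Real.exp (-(1 * sqNorm h))) (vectorLaw N) := by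
  refine (integrable_const (1 : ℝ)).mono' (Measurable.aestronglyMeasurable (by fun_prop))
    (ae_of_all _ fun h => ?_)
  rw [Real.norm_eq_abs, Real.abs_exp]
  exact Real.exp_le_one_iff.2 (by linarith [sqNorm_nonneg h])

theorem integrable_offDiagonal (c : ℝ) (i j : Fin M) :
    Integrable (fun hI : Fin M → Fin N → ℂ => if i = j then 0 else
      c * ‖star (hI i) ⬝ᵥ hI j‖ ^ 2) (Measure.pi fun _ => vectorLaw N) := by
  split_ifs with h
  · exact integrable_zero _ _ _
  · exact ((measurePreserving_eval_pair h).integrable_comp_of_integrable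
      integrable_norm_star_dotProduct_sq).const_mul c

theorem integral_offDiagonal_le {c : ℝ} (hc : 0 ≤ c) (i j : Fin M) :
    ∫ hI : Fin M → Fin N → ℂ, (if i = j then 0 else c * ‖star (hI i) ⬝ᵥ hI j‖ ^ 2)
      ∂(Measure.pi fun _ => vectorLaw N) ≤ c * N := by
  split_ifs with h
  · simp only [integral_zero]; positivity
  · rw [integral_const_mul]
    have h1 := measurePreserving_eval_pair (N := N) h
    have h2 := integral_map (μ := Measure.pi fun _ : Fin M => vectorLaw N)
      h1.measurable.aemeasurable
      (f := fun p : (Fin N → ℂ) × (Fin N → ℂ) => ‖star p.1 ⬝ᵥ p.2‖ ^ 2)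
      measurable_norm_star_dotProduct_sq.aestronglyMeasurable
    rw [h1.map_eq, integral_norm_star_dotProduct_sq] at h2
    rw [h2]

theorem integrable_exp_neg_sqNorm_eval (i : Fin M) :
    Integrable (fun hI : Fin M → Fin N → ℂ => Real.exp (-(1 * sqNorm (hI i))))
      (Measure.pi fun _ => vectorLaw N) :=
  (measurePreserving_eval (fun _ : Fin M => vectorLaw N) i).integrable_comp_of_integrable
    integrable_exp_neg_sqNorm

theorem integral_exp_neg_sqNorm_eval (i : Fin M) :
    ∫ hI : Fin M → Fin N → ℂ, Real.exp (-(1 * sqNorm (hI i)))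
      ∂(Measure.pi fun _ => vectorLaw N) = (2 ^ N)⁻¹ := by
  have h1 := measurePreserving_eval (fun _ : Fin M => vectorLaw N) i
  have h2 := integral_map (μ := Measure.pi fun _ : Fin M => vectorLaw N)
    h1.measurable.aemeasurable (f := fun h : Fin N → ℂ => Real.exp (-(1 * sqNorm h)))
    (Measurable.aestronglyMeasurable (by fun_prop))
  rw [h1.map_eq, integral_exp_neg_mul_sqNorm N zero_le_one] at h2
  rw [show (2 : ℝ) = 1 + 1 by norm_num, h2]

theorem integrable_dependenceBound :
    Integrable (dependenceBound : (Fin M → Fin N → ℂ) → ℝ) (Measure.pi fun _ => vectorLaw N) :=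
  integrable_finsetSum _ fun i _ => ((integrable_exp_neg_sqNorm_eval i).const_mul _).add
    (integrable_finsetSum _ fun j _ => integrable_offDiagonal _ i j)

theorem exp_half_mul_inv_two_pow (N : ℕ) :
    Real.exp (N / 2) * (2 ^ N)⁻¹ = (Real.exp (1 / 2) / 2) ^ N := by
  rw [div_pow, ← Real.exp_nat_mul, div_eq_mul_inv]
  congr 2
  ring

theorem integral_dependenceBound_le (hN : 0 < N) :
    ∫ hI : Fin M → Fin N → ℂ, dependenceBound hI ∂(Measure.pi fun _ => vectorLaw N) ≤
      M * (Real.exp (1 / 2) / 2) ^ N + 4 * (M : ℝ) ^ 4 / N := by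
  have hN' : (0 : ℝ) < N := Nat.cast_pos.2 hN
  have hrow : ∀ i : Fin M, Integrable (fun hI : Fin M → Fin N → ℂ =>
      Real.exp (N / 2) * Real.exp (-(1 * sqNorm (hI i))) +
        ∑ j, if i = j then 0 else 4 * (M : ℝ) ^ 2 / (N : ℝ) ^ 2 * ‖star (hI i) ⬝ᵥ hI j‖ ^ 2)
      (Measure.pi fun _ => vectorLaw N) := fun i =>
    ((integrable_exp_neg_sqNorm_eval i).const_mul _).add
      (integrable_finsetSum _ fun j _ => integrable_offDiagonal _ i j)
  unfold dependenceBound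
  rw [integral_finsetSum _ fun i _ => hrow i]
  have hi : ∀ i : Fin M, ∫ hI : Fin M → Fin N → ℂ,
      (Real.exp (N / 2) * Real.exp (-(1 * sqNorm (hI i))) +
        ∑ j, if i = j then 0 else 4 * (M : ℝ) ^ 2 / (N : ℝ) ^ 2 * ‖star (hI i) ⬝ᵥ hI j‖ ^ 2)
        ∂(Measure.pi fun _ => vectorLaw N) ≤
      (Real.exp (1 / 2) / 2) ^ N + M * (4 * (M : ℝ) ^ 2 / (N : ℝ) ^ 2 * N) := by
    intro i
    rw [integral_add ((integrable_exp_neg_sqNorm_eval i).const_mul _)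
      (integrable_finsetSum _ fun j _ => integrable_offDiagonal _ i j), integral_const_mul,
      integral_exp_neg_sqNorm_eval, exp_half_mul_inv_two_pow,
      integral_finsetSum _ fun j _ => integrable_offDiagonal _ i j]
    gcongr
    calc _ ≤ ∑ _j : Fin M, 4 * (M : ℝ) ^ 2 / (N : ℝ) ^ 2 * N :=
          Finset.sum_le_sum fun j _ => integral_offDiagonal_le (by positivity) i j
      _ = _ := by simp
  calc _ ≤ ∑ _i : Fin M, ((Real.exp (1 / 2) / 2) ^ N + M * (4 * (M : ℝ) ^ 2 / (N : ℝ) ^ 2 * N)) :=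
        Finset.sum_le_sum fun i _ => hi i
    _ = _ := by
        rw [Finset.sum_const, Finset.card_univ, Fintype.card_fin, nsmul_eq_mul]
        field_simp

end Interferers

/-! ### The loss caused by zero forcing -/

section Loss

variable {N M : ℕ}

open Classical in
/-- The part `h₁†(I - P)h₁` of the source power that zero forcing discards, cut off where the
interferer channels are linearly dependent. -/
noncomputable def zfLoss (h : Channel N M) : ℝ :=
  if NondegenerateInterferers h.2.2 then sqNorm h.1 - zfGain h else 0

theorem zfLoss_nonneg (h : Channel N M) : 0 ≤ zfLoss h := by
  unfold zfLoss
  split_ifs with hh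
  · linarith [zfGain_le_sqNorm hh]
  · exact le_rfl

theorem integrable_zfLoss : Integrable (zfLoss : Channel N M → ℝ) (channelLaw N M) := by
  have h1 : Integrable (fun h : Channel N M => sqNorm h.1) (channelLaw N M) :=
    (integrable_sqNorm N).comp_fst _
  have hm : Measurable (zfLoss : Channel N M → ℝ) := by
    unfold zfLoss
    refine Measurable.ite ?_ (by
      have := measurable_zfGain (N := N) (M := M)
      fun_prop) measurable_const
    exact (by fun_prop : Measurable fun h : Channel N M => h.2.2)
      measurableSet_nondegenerateInterferers
  refine h1.mono' hm.aestronglyMeasurable (ae_of_all _ fun h => ?_)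
  rw [Real.norm_of_nonneg (zfLoss_nonneg h), zfLoss]
  split_ifs with hh
  · linarith [zfGain_nonneg hh]
  · exact sqNorm_nonneg _

/-- Given the interferers, P is a fixed matrix independent of h₁, so the conditional mean is tr(I -
P) = M, or 0 after the cut-off. -/
theorem integral_zfLoss_le : ∫ h, zfLoss h ∂(channelLaw N M) ≤ M := by
  have hint := integrable_zfLoss (N := N) (M := M)
  have : SFinite ((vectorLaw N).prod (Measure.pi fun _ : Fin M => vectorLaw N)) :=
    Measure.prod.instSFinite
  unfold channelLaw at hint ⊢
  rw [integral_prod_symm _ hint]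
  have hinner : ∀ y : (Fin N → ℂ) × (Fin M → Fin N → ℂ),
      ∫ x, zfLoss ((x, y) : Channel N M) ∂(vectorLaw N) ≤ M := by
    intro y
    by_cases hh : NondegenerateInterferers y.2
    · have hform : ∀ x, zfLoss ((x, y) : Channel N M) =
          (star x ⬝ᵥ (1 - zfProjection (interfererMatrix y.2)).mulVec x).re := by
        intro x
        rw [zfLoss, if_pos hh, Matrix.sub_mulVec, dotProduct_sub, Matrix.one_mulVec,
          star_dotProduct_self_eq_sqNorm, Complex.sub_re, Complex.ofReal_re]
        rfl
      simp_rw [hform]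
      have h1 := Complex.reCLM.integral_comp_comm
        (integrable_quadraticForm (1 - zfProjection (interfererMatrix y.2)))
      simp only [Complex.reCLM_apply] at h1
      rw [h1, integral_quadraticForm, trace_one_sub_zfProjection hh, Complex.natCast_re]
    · have hform : ∀ x, zfLoss ((x, y) : Channel N M) = 0 := fun x => by
        rw [zfLoss, if_neg hh]
      simp_rw [hform]
      simp
  have hprob : IsProbabilityMeasure ((vectorLaw N).prod
    (Measure.pi fun _ : Fin M => vectorLaw N)) := inferInstance
  calc _ ≤ ∫ _y, (M : ℝ) ∂((vectorLaw N).prod (Measure.pi fun _ : Fin M => vectorLaw N)) :=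
        integral_mono hint.integral_prod_right (integrable_const _) hinner
    _ = M := by simp

/-- log(1+A) ≤ 2√A, followed by the arithmetic–geometric mean inequality. The bound is linear in A,
so it can be integrated; c = √N suits A of order N. -/
theorem log_one_add_le_div_add {A c : ℝ} (hA : 0 ≤ A) (hc : 0 < c) :
    Real.log (1 + A) ≤ A / c + c := by
  have h1 : Real.log (1 + A) ≤ 2 * √A := by
    have h2 := Real.log_le_sub_one_of_pos (x := 1 + √A) (by positivity)
    have h3 : Real.log (1 + A) ≤ Real.log ((1 + √A) ^ 2) := by
      apply Real.log_le_log (by positivity)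
      nlinarith [Real.sq_sqrt hA, Real.sqrt_nonneg A]
    rw [Real.log_pow] at h3
    push_cast at h3
    linarith
  refine h1.trans ?_
  rw [div_add' _ _ _ hc.ne', le_div_iff₀ hc]
  nlinarith [Real.sq_sqrt hA, sq_nonneg (√A - c)]

/-- Bernoulli's inequality (1+A)^t ≤ 1 + tA. -/
theorem mul_log_one_add_le {A t : ℝ} (hA : 0 ≤ A) (ht0 : 0 ≤ t) (ht1 : t ≤ 1) :
    t * Real.log (1 + A) ≤ Real.log (1 + t * A) := by
  rw [← Real.log_rpow (by positivity)]
  exact Real.log_le_log (by positivity)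
    (rpow_one_add_le_one_add_mul_self (by linarith) ht0 ht1)

theorem log_snr_sub_log_snr_le {a A B : ℝ} (ha : 0 ≤ a) (haA : a ≤ A) (hB : 0 ≤ B) :
    Real.log (1 + A * B / (A + B + 1)) - Real.log (1 + a * B / (a + B + 1)) ≤
      Real.log (1 + A) - Real.log (1 + a) := by
  have hA : 0 ≤ A := ha.trans haA
  rw [log_one_add_mul_div ha hB, log_one_add_mul_div hA hB]
  have := Real.log_le_log (by positivity : 0 < 1 + (a + B)) (by linarith : _ ≤ 1 + (A + B))
  linarith

/-- `log (1 + ρ x) - log (1 + ρ q)` is small on average when `x - q` is bounded on average and `x`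
is of order `n`. -/
theorem log_sub_log_le {ρ x q n : ℝ} (hρ : 0 < ρ) (hq : 0 ≤ q) (hqx : q ≤ x) (hn : 0 < n) :
    Real.log (1 + ρ * x) - Real.log (1 + ρ * q) ≤
      (ρ + 2) / √n * (x - q) + √n * (Real.exp (n / 2) * Real.exp (-(1 * x))) := by
  have hc : 0 < √n := Real.sqrt_pos.2 hn
  rcases (hq.trans hqx).eq_or_lt with h0 | hx
  · have : q = 0 := by linarith
    subst this
    rw [← h0, sub_self, sub_self, mul_zero, zero_add]
    positivity
  -- Taking t = q/x bounds the difference by ((x - q)/x) log(1+ρx); the factor 1/x then cancels the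
  -- linear part ρx/√n of the logarithm bound.
  have hr := mul_log_one_add_le (A := ρ * x) (t := q / x) (by positivity) (by positivity)
    ((div_le_one hx).2 hqx)
  rw [show q / x * (ρ * x) = ρ * q by field_simp] at hr
  have hr0 : 0 ≤ (x - q) / x := div_nonneg (by linarith) hx.le
  have hlog := mul_le_mul_of_nonneg_left (log_one_add_le_div_add (A := ρ * x) (by positivity) hc)
    hr0
  have hsplit : (x - q) / x * Real.log (1 + ρ * x) =
      Real.log (1 + ρ * x) - q / x * Real.log (1 + ρ * x) := by field_simp
  have hmain : (x - q) / x * (ρ * x / √n + √n) = ρ / √n * (x - q) + (x - q) / x * √n := by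
    field_simp
  have hrest : (x - q) / x * √n ≤
      2 / √n * (x - q) + √n * (Real.exp (n / 2) * Real.exp (-(1 * x))) := by
    -- Either 1/x ≤ 2/n, or the Chernoff factor e^(n/2 - x) is at least 1.
    rcases le_total (n / 2) x with hnx | hnx
    · have h1 : (x - q) / x * √n ≤ 2 / √n * (x - q) := by
        rw [div_mul_eq_mul_div, div_mul_eq_mul_div, div_le_div_iff₀ hx hc, mul_assoc,
          Real.mul_self_sqrt hn.le]
        nlinarith
      have h2 : 0 ≤ √n * (Real.exp (n / 2) * Real.exp (-(1 * x))) := by positivity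
      linarith
    · have h1 : (x - q) / x ≤ 1 := (div_le_one hx).2 (by linarith)
      have h2 : 1 ≤ Real.exp (n / 2) * Real.exp (-(1 * x)) := by
        rw [← Real.exp_add]
        exact Real.one_le_exp (by linarith)
      have h3 : 0 ≤ 2 / √n * (x - q) := mul_nonneg (by positivity) (by linarith)
      nlinarith [mul_le_mul_of_nonneg_right (h1.trans h2) hc.le]
  have : (ρ + 2) / √n * (x - q) = ρ / √n * (x - q) + 2 / √n * (x - q) := by ring
  linarith

/-- Upper bound for the loss of mutual information (in nats, up to the factor `1/2`). -/
noncomputable def lossBound (ρ₁ : ℝ) (h : Channel N M) : ℝ :=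
  (ρ₁ + 2) / √N * zfLoss h + √N * (Real.exp (N / 2) * Real.exp (-(1 * sqNorm h.1))) +
    (ρ₁ * sqNorm h.1 / √N + √N) * dependenceBound h.2.2

theorem mutualInfo_snrFree_sub_le {ρ₁ ρ₂ γ : ℝ} (hρ₁ : 0 < ρ₁) (hρ₂ : 0 ≤ ρ₂) (hN : 0 < N)
    {h : Channel N M} (hγ : 0 ≤ γ)
    (hle : NondegenerateInterferers h.2.2 →
      ρ₁ * zfGain h * (ρ₂ * sqNorm h.2.1) / (ρ₁ * zfGain h + ρ₂ * sqNorm h.2.1 + 1) ≤ γ) :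
    mutualInfo (snrFree ρ₁ ρ₂ (h.1, h.2.1)) - mutualInfo γ ≤
      (2 * Real.log 2)⁻¹ * lossBound ρ₁ h := by
  have h2 : 0 < Real.log 2 := Real.log_pos (by norm_num)
  have hN' : (0 : ℝ) < N := Nat.cast_pos.2 hN
  have hA : 0 ≤ ρ₁ * sqNorm h.1 := mul_nonneg hρ₁.le (sqNorm_nonneg _)
  have hB : 0 ≤ ρ₂ * sqNorm h.2.1 := mul_nonneg hρ₂ (sqNorm_nonneg _)
  have hdep := dependenceBound_nonneg h.2.2
  rw [mutualInfo_eq, mutualInfo_eq, ← mul_sub]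
  gcongr
  by_cases hh : NondegenerateInterferers h.2.2
  · have hq := zfGain_nonneg hh
    have h1 := log_snr_sub_log_snr_le (a := ρ₁ * zfGain h) (A := ρ₁ * sqNorm h.1) (by positivity)
      (mul_le_mul_of_nonneg_left (zfGain_le_sqNorm hh) hρ₁.le) hB
    have h3 := log_sub_log_le hρ₁ hq (zfGain_le_sqNorm hh) hN'
    have h4 := Real.log_le_log (by positivity) (add_le_add_right (hle hh) 1)
    have h5 : 0 ≤ (ρ₁ * sqNorm h.1 / √N + √N) * dependenceBound h.2.2 := by positivity
    rw [lossBound, zfLoss, if_pos hh, snrFree]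
    linarith
  -- On the degenerate event the gap is bounded crudely by log(1+ρ₁‖h₁‖²), and a factor at least 1
  -- is inserted. That factor depends only on the interferers, so it is independent of h₁ and the
  -- means multiply.
  · have h1 := one_le_dependenceBound hN hh
    have h3 := log_one_add_le_div_add hA (Real.sqrt_pos.2 hN')
    have h4 : Real.log (1 + snrFree ρ₁ ρ₂ (h.1, h.2.1)) ≤ Real.log (1 + ρ₁ * sqNorm h.1) :=
      Real.log_le_log (by linarith [snrFree_nonneg hρ₁.le hρ₂ (h.1, h.2.1)])
        (by linarith [snrFree_le hρ₁.le hρ₂ (h.1, h.2.1)])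
    have h5 : 0 ≤ Real.log (1 + γ) := Real.log_nonneg (by linarith)
    have h6 : 0 ≤ √N * (Real.exp (N / 2) * Real.exp (-(1 * sqNorm h.1))) := by positivity
    have h7 : ρ₁ * sqNorm h.1 / √N + √N ≤
        (ρ₁ * sqNorm h.1 / √N + √N) * dependenceBound h.2.2 :=
      le_mul_of_one_le_right (by positivity) h1
    rw [lossBound, zfLoss, if_neg hh, mul_zero]
    linarith

theorem integrable_dependenceTerm (ρ₁ c : ℝ) :
    Integrable (fun h : Channel N M => (ρ₁ * sqNorm h.1 / c + c) * dependenceBound h.2.2)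
      (channelLaw N M) := by
  have h1 : Integrable (fun h : Fin N → ℂ => ρ₁ * sqNorm h / c + c) (vectorLaw N) :=
    (((integrable_sqNorm N).const_mul ρ₁).div_const c).add (integrable_const _)
  have h2 : Integrable (fun p : (Fin N → ℂ) × (Fin M → Fin N → ℂ) => dependenceBound p.2)
      ((vectorLaw N).prod (Measure.pi fun _ => vectorLaw N)) :=
    integrable_dependenceBound.comp_snd _
  exact h1.mul_prod h2

theorem integrable_expTerm (c : ℝ) :
    Integrable (fun h : Channel N M => c * (Real.exp (N / 2) * Real.exp (-(1 * sqNorm h.1))))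
      (channelLaw N M) :=
  ((integrable_exp_neg_sqNorm.comp_fst _).const_mul _).const_mul _

theorem integrable_lossBound (ρ₁ : ℝ) :
    Integrable (lossBound ρ₁ : Channel N M → ℝ) (channelLaw N M) :=
  ((integrable_zfLoss.const_mul _).add (integrable_expTerm _)).add (integrable_dependenceTerm _ _)

/-- The discarded power contributes M/√N, the Chernoff term √N (√e/2)^N, and the degenerate event √N
times O(1/N), each up to constants in ρ₁ and M. -/
theorem integral_lossBound_le {ρ₁ : ℝ} (hρ₁ : 0 ≤ ρ₁) (hN : 0 < N) :
    ∫ h, lossBound ρ₁ h ∂(channelLaw N M) ≤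
      ((ρ₁ + 2) * M + (ρ₁ + 1) * (4 * (M : ℝ) ^ 4)) * (√N)⁻¹ +
        (1 + (ρ₁ + 1) * M) * (N * (Real.exp (1 / 2) / 2) ^ N) := by
  have hN' : (0 : ℝ) < N := Nat.cast_pos.2 hN
  have hc : 0 < √(N : ℝ) := Real.sqrt_pos.2 hN'
  have hcc : √(N : ℝ) * √(N : ℝ) = N := Real.mul_self_sqrt hN'.le
  have hc1 : (1 : ℝ) ≤ √N := Real.one_le_sqrt.2 (by exact_mod_cast hN)
  have hcN : √(N : ℝ) ≤ N := by nlinarith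
  set r := Real.exp (1 / 2) / 2 with hr
  have hr0 : 0 ≤ r := by positivity
  have hE : ∫ h : Channel N M, √N * (Real.exp (N / 2) * Real.exp (-(1 * sqNorm h.1)))
      ∂(channelLaw N M) = √N * r ^ N := by
    have : SFinite ((vectorLaw N).prod (Measure.pi fun _ : Fin M => vectorLaw N)) :=
      Measure.prod.instSFinite
    rw [integral_const_mul, integral_const_mul]
    unfold channelLaw
    rw [integral_fun_fst (fun h : Fin N → ℂ => Real.exp (-(1 * sqNorm h))),
      integral_exp_neg_mul_sqNorm N zero_le_one, one_add_one_eq_two, ← exp_half_mul_inv_two_pow]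
    simp
  have hZ : ∫ h : Channel N M, (ρ₁ * sqNorm h.1 / √N + √N) * dependenceBound h.2.2
      ∂(channelLaw N M) ≤ (ρ₁ + 1) * √N * (M * r ^ N + 4 * (M : ℝ) ^ 4 / N) := by
    have : SFinite ((vectorLaw N).prod (Measure.pi fun _ : Fin M => vectorLaw N)) :=
      Measure.prod.instSFinite
    unfold channelLaw
    rw [integral_prod_mul (fun h : Fin N → ℂ => ρ₁ * sqNorm h / √N + √N)
      (fun p : (Fin N → ℂ) × (Fin M → Fin N → ℂ) => dependenceBound p.2),
      integral_fun_snd (fun hI : Fin M → Fin N → ℂ => dependenceBound hI),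
      integral_add (((integrable_sqNorm N).const_mul ρ₁).div_const _) (integrable_const _),
      integral_div, integral_const_mul, integral_sqNorm]
    have h1 : ρ₁ * (N : ℝ) / √N + √N = (ρ₁ + 1) * √N := by
      field_simp
      linear_combination (-ρ₁) * hcc
    have h2 := integral_dependenceBound_le (M := M) hN
    simp only [integral_const, probReal_univ, one_smul]
    rw [h1]
    gcongr
  have hsum : ∫ h, lossBound ρ₁ h ∂(channelLaw N M) ≤ (ρ₁ + 2) / √N * M + √N * r ^ N +
      (ρ₁ + 1) * √N * (M * r ^ N + 4 * (M : ℝ) ^ 4 / N) := by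
    have hadd : Integrable (fun h : Channel N M => (ρ₁ + 2) / √N * zfLoss h +
        √N * (Real.exp (N / 2) * Real.exp (-(1 * sqNorm h.1)))) (channelLaw N M) :=
      (integrable_zfLoss.const_mul _).add (integrable_expTerm _)
    unfold lossBound
    rw [integral_add hadd (integrable_dependenceTerm _ _),
      integral_add (integrable_zfLoss.const_mul _) (integrable_expTerm _), hE, integral_const_mul]
    gcongr
    exact integral_zfLoss_le
  refine hsum.trans ?_
  have h4 : √(N : ℝ) * (4 * (M : ℝ) ^ 4 / N) = 4 * (M : ℝ) ^ 4 * (√N)⁻¹ := by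
    field_simp
    linear_combination (M : ℝ) ^ 4 * hcc
  have h5 : √(N : ℝ) * r ^ N ≤ N * r ^ N := by gcongr
  calc _ = ((ρ₁ + 2) * M + (ρ₁ + 1) * (4 * (M : ℝ) ^ 4)) * (√N)⁻¹ +
        (1 + (ρ₁ + 1) * M) * (√(N : ℝ) * r ^ N) := by
        linear_combination (ρ₁ + 1) * h4
    _ ≤ _ := by gcongr

end Loss

/-! ### Convergence of the capacities -/

theorem tendsto_lossBound (ρ₁ : ℝ) (M : ℕ) :
    Tendsto (fun N : ℕ => ((ρ₁ + 2) * M + (ρ₁ + 1) * (4 * (M : ℝ) ^ 4)) * (√(N : ℝ))⁻¹ +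
      (1 + (ρ₁ + 1) * M) * (N * (Real.exp (1 / 2) / 2) ^ N)) atTop (𝓝 0) := by
  have h1 : Tendsto (fun N : ℕ => (√(N : ℝ))⁻¹) atTop (𝓝 0) :=
    (Real.tendsto_sqrt_atTop.comp tendsto_natCast_atTop_atTop).inv_tendsto_atTop
  -- Equivalent to e < 4.
  have hlt : Real.exp (1 / 2) / 2 < 1 := by
    have h2 : Real.exp (1 / 2) * Real.exp (1 / 2) = Real.exp 1 := by
      rw [← Real.exp_add]; norm_num
    have h3 := Real.exp_one_lt_three
    nlinarith [Real.exp_pos (1 / 2)]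
  have h2 := tendsto_self_mul_const_pow_of_lt_one (by positivity) hlt
  simpa using (h1.const_mul ((ρ₁ + 2) * M + (ρ₁ + 1) * (4 * (M : ℝ) ^ 4))).add
    (h2.const_mul (1 + (ρ₁ + 1) * M))

/-- The ergodic capacity of every scheme whose SINR lies between that of zero forcing and that of
the interference-free system approaches the interference-free capacity. -/
theorem tendsto_capacity_sub_capacityLN {M : ℕ} {ρ₁ ρ₂ : ℝ} (hρ₁ : 0 < ρ₁) (hρ₂ : 0 < ρ₂)
    (X : ∀ N, Channel N M → ℝ) (hX : ∀ N, Measurable (X N)) (h0 : ∀ N h, 0 ≤ X N h)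
    (hle : ∀ N h, X N h ≤ snrFree ρ₁ ρ₂ (h.1, h.2.1))
    (hge : ∀ N (h : Channel N M), NondegenerateInterferers h.2.2 →
      ρ₁ * zfGain h * (ρ₂ * sqNorm h.2.1) / (ρ₁ * zfGain h + ρ₂ * sqNorm h.2.1 + 1) ≤ X N h) :
    Tendsto (fun N : ℕ => ((∫ h, mutualInfo (X N h) ∂(channelLaw N M) : ℝ) : ℂ) -
      capacityLN N ρ₁ ρ₂) atTop (𝓝 0) := by
  have hint : ∀ N, Integrable (fun h => mutualInfo (X N h)) (channelLaw N M) := fun N =>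
    integrable_mutualInfo_of_le_snrFree hρ₁.le hρ₂.le (hX N) (h0 N) (hle N)
  have hfree : ∀ N, Integrable (fun h : Channel N M => mutualInfo (snrFree ρ₁ ρ₂ (h.1, h.2.1)))
      (channelLaw N M) := fun N =>
    (measurePreserving_channelLaw N M).integrable_comp_of_integrable
      (integrable_mutualInfo_snrFree (N := N) hρ₁.le hρ₂.le)
  have hcap : ∀ N, capacityFree N ρ₁ ρ₂ =
      ∫ h : Channel N M, mutualInfo (snrFree ρ₁ ρ₂ (h.1, h.2.1)) ∂(channelLaw N M) := by
    intro N
    have h1 := measurePreserving_channelLaw N M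
    have h2 := integral_map (μ := channelLaw N M) h1.measurable.aemeasurable
      (f := fun p => mutualInfo (snrFree ρ₁ ρ₂ p))
      (measurable_mutualInfo.comp measurable_snrFree).aestronglyMeasurable
    rw [h1.map_eq] at h2
    exact h2
  have hlim : Tendsto (fun N : ℕ => capacityFree N ρ₁ ρ₂ -
      ∫ h, mutualInfo (X N h) ∂(channelLaw N M)) atTop (𝓝 0) := by
    have hbound := (tendsto_lossBound ρ₁ M).const_mul (2 * Real.log 2)⁻¹
    rw [mul_zero] at hbound
    have h2 : 0 < Real.log 2 := Real.log_pos (by norm_num)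
    refine tendsto_of_tendsto_of_tendsto_of_le_of_le' tendsto_const_nhds hbound
      (Eventually.of_forall fun N => ?_) ?_
    · rw [hcap, ← integral_sub (hfree N) (hint N)]
      exact integral_nonneg fun h => sub_nonneg.2 (mutualInfo_mono (h0 N h) (hle N h))
    · filter_upwards [eventually_gt_atTop 0] with N hN
      rw [hcap, ← integral_sub (hfree N) (hint N)]
      calc _ ≤ ∫ h : Channel N M, (2 * Real.log 2)⁻¹ * lossBound ρ₁ h ∂(channelLaw N M) :=
            integral_mono ((hfree N).sub (hint N)) ((integrable_lossBound ρ₁).const_mul _)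
              fun h => mutualInfo_snrFree_sub_le hρ₁ hρ₂.le hN (h0 N h) (hge N h)
        _ ≤ _ := by
            rw [integral_const_mul]
            gcongr
            exact integral_lossBound_le hρ₁.le hN
  have hneg := hlim.neg
  rw [neg_zero] at hneg
  refine ((Complex.continuous_ofReal.tendsto' 0 0 Complex.ofReal_zero).comp hneg).congr fun N => ?_
  rw [← capacityFree_eq_capacityLN hρ₁ hρ₂]
  simp

theorem theorem6 (ρ₁ ρ₂ : ℝ) (hρ₁ : 0 < ρ₁) (hρ₂ : 0 < ρ₂) :
    -- the interference-free capacity is finite and has an exact closed form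
    (∀ N : ℕ,
      Integrable (fun h => mutualInfo (snrFree ρ₁ ρ₂ h)) ((vectorLaw N).prod (vectorLaw N)) ∧
      (capacityFree N ρ₁ ρ₂ : ℂ) = capacityLN N ρ₁ ρ₂) ∧
    -- the ZF/MRT capacity is approximated by it as `N → ∞` with `M` fixed
    (∀ (M : ℕ) (ρI : Fin M → ℝ), (∀ i, 0 ≤ ρI i) →
      (∀ N : ℕ, M < N →
        Integrable (fun h => mutualInfo (sinrZF ρ₁ ρ₂ ρI h)) (channelLaw N M)) ∧
      Tendsto (fun N : ℕ => (capacityZF N M ρ₁ ρ₂ ρI : ℂ) - capacityLN N ρ₁ ρ₂) atTop (𝓝 0)) ∧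
    -- and so is the MMSE/MRT capacity, with interferers of equal power
    (∀ (M : ℕ) (ρI : ℝ), 0 < ρI →
      (∀ N : ℕ,
        Integrable (fun h => mutualInfo (sinrMMSE ρ₁ ρ₂ ρI h)) (channelLaw N M)) ∧
      Tendsto (fun N : ℕ => (capacityMMSE N M ρ₁ ρ₂ ρI : ℂ) - capacityLN N ρ₁ ρ₂)
        atTop (𝓝 0)) := by
  refine ⟨fun N => ⟨integrable_mutualInfo_snrFree hρ₁.le hρ₂.le,
    capacityFree_eq_capacityLN hρ₁ hρ₂ N⟩, fun M ρI hρI => ?_, fun M ρI hρI => ?_⟩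
  · have hX := fun N : ℕ => measurable_sinrZF (N := N) hρ₁.le hρ₂.le hρI
    have h0 := fun (N : ℕ) (h : Channel N M) =>
      sinr_relayMatrix_nonneg hρ₁.le hρ₂.le hρI h (zfCombiner h)
    have hle := fun (N : ℕ) (h : Channel N M) =>
      sinr_relayMatrix_le_snrFree hρ₁.le hρ₂.le hρI h (zfCombiner h)
    exact ⟨fun N _ => integrable_mutualInfo_of_le_snrFree hρ₁.le hρ₂.le (hX N) (h0 N) (hle N),
      tendsto_capacity_sub_capacityLN hρ₁ hρ₂ (fun N h => sinrZF ρ₁ ρ₂ ρI h) hX h0 hle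
        fun N h hh => le_sinrZF hρ₁.le hρ₂.le hρI hh⟩
  · have hX := fun N : ℕ => measurable_sinrMMSE (N := N) (M := M) hρ₁.le hρ₂.le hρI.le
    have h0 := fun (N : ℕ) (h : Channel N M) =>
      sinr_relayMatrix_nonneg hρ₁.le hρ₂.le (fun _ => hρI.le) h (mmseCombiner ρI h)
    have hle := fun (N : ℕ) (h : Channel N M) =>
      sinr_relayMatrix_le_snrFree hρ₁.le hρ₂.le (fun _ => hρI.le) h (mmseCombiner ρI h)
    exact ⟨fun N => integrable_mutualInfo_of_le_snrFree hρ₁.le hρ₂.le (hX N) (h0 N) (hle N),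
      tendsto_capacity_sub_capacityLN hρ₁ hρ₂ (fun N h => sinrMMSE ρ₁ ρ₂ ρI h) hX h0 hle
        fun N h hh => le_sinrMMSE hρ₁.le hρ₂.le hρI hh⟩
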